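/- **Setting.** Let $t_0\le t_f$ and consider $\dot x=A_o(t)x+B_o(t)u+F_o(t)w+E\phi(t,q_o)$, $q_o=C_ox+D_ou+G_ow$ on $[t_0,t_f]$, with $A_o,B_o,F_o$ continuous, $E,C_o,D_o,G_o$ constant, and $\phi(t,\cdot):\mathbb R^{n_{q_o}}\to\mathbb R^{n_p}$ differentiable with Jacobian jointly continuous in $(t,q)$. Let $\bar x$ be a continuous and $\bar u$ a measurable bounded (for instance piecewise continuous) nominal trajectory. Put $\phi'(t)=\partial_q\phi(t,C_o\bar x(t)+D_o\bar u(t))$, $A=A_o+E\phi' C_o$, $B=B_o+E\phi' D_o$, $F=F_o+E\phi' G_o$. Let $C,D,G$ be constant matrices with $n_q$ rows, divided into row blocks $C_i,D_i,G_i$ ($1\le i\le n_c$). Let $T_{11},T_{12},T_{21},T_{22}$ (of sizes $n_q\times n_q$, $n_q\times n_p$, $n_p\times n_q$, $n_p\times n_p$) be measurable bounded functions of $t\in[t_0,t_f]$ with $T_{22}(t)$ nonsingular and $T_{22}^{-1}$ bounded, and put $\Lambda=T_{12}T_{22}^{-1}$, $\Sigma=T_{11}-T_{12}T_{22}^{-1}T_{21}$.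 Let $h_i:\mathbb R^{n_x}\to\mathbb R$ and $g_j:\mathbb R^{n_u}\to\mathbb R$ be finitely many $C^1$ functions and $\alpha,c_Q\in\mathbb R$. Put $a_i^h=\nabla h_i(\bar x)$, $b_i^h=(a_i^h)^\top\bar x-h_i(\bar x)$, $a_j^g=\nabla g_j(\bar u)$, $b_j^g=(a_j^g)^\top\bar u-g_j(\bar u)$. The input variables are $\zeta=(Y,Z,N_1,N_2,\lambda_w,s)$ with $Y\in\mathbb R^{n_u\times n_x}$, symmetric matrices $Z,N_1,N_2$ of sizes $n_x,n_q,n_p$, $\lambda_w\in\mathbb R$ and $s\in\mathbb R^{n_c}$. With $$H_{11}=AQ+BY-ET_{22}^{-1}T_{21}(CQ+DY)+\tfrac{\alpha}{2}Q,$$ the funnel dynamics are either $\dot Q=H_{11}+H_{11}^\top+Z$ (Lyapunov type) or $\dot Q=Z$ (direct type). Let $t_k=t_0+\frac kN(t_f-t_0)$ with $0\le k<N$. The decision variable on $[t_k,t_{k+1}]$ is $\chi_k=(Q_k,\zeta_k^m,\zeta_{k+1}^p)$ with $Q_k$ symmetric; it ranges over the finite-dimensional space $\mathbb X$ of such tuples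 with the Euclidean inner product of the vectorized entries. It determines $\zeta(t)=\frac{t_{k+1}-t}{t_{k+1}-t_k}\zeta_k^m+\frac{t-t_k}{t_{k+1}-t_k}\zeta_{k+1}^p$ and the solution $Q(t)$ of the funnel dynamics on $[t_k,t_{k+1}]$ with input $\zeta(\cdot)$ and $Q(t_k)=Q_k$. Let $L_l(t,\chi_k)$ denote any one of the following symmetric matrices, evaluated at $(t,Q(t),\zeta(t))$ ($\star$ marks the transpose of the opposite block): * the invariance matrix $\begin{bmatrix}H_0&\star\\H_{12}&H_{22}\end{bmatrix}$, where $H_0=-Z$ for the Lyapunov type, $H_0=H_{11}+H_{11}^\top-Z$ for the direct type, $H_{12}=\begin{bmatrix}N_2T_{22}^{-\top}E^\top\\F^\top-G^\top T_{21}^\top T_{22}^{-\top}E^\top\\\Sigma(CQ+DY)\end{bmatrix}$ and $H_{22}=\begin{bmatrix}-N_2&\star&\star\\0&-\lambda_wI&\star\\\Lambda N_2&\Sigma G&-N_1\end{bmatrix}$; * for a state constraint $i$, $-\begin{bmatrix}(b_i^h-(a_i^h)^\top\bar x)^2&\star\\c_QQa_i^h&c_QQ\end{bmatrix}$; * for an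 input constraint $j$, $-\begin{bmatrix}(b_j^g-(a_j^g)^\top\bar u)^2&\star\\c_QY^\top a_j^g&c_QQ\end{bmatrix}$; * for a channel $i$, the L-smoothness matrix $-\begin{bmatrix}s_iI&C_iQ+D_iY\\\star&Q\end{bmatrix}$. **Theorem.** Let $p\ge1$ be real, let $0\le k<N$, and put $f(t,\chi)=\max(0,\lambda_{\max}(L_l(t,\chi)))^{p}$, where $\lambda_{\max}$ is the largest eigenvalue. There is a function $\tilde g:[t_k,t_{k+1}]\times\mathbb X\to\mathbb X$ such that, for every $\chi_k\in\mathbb X$, the map $t\mapsto\tilde g(t,\chi_k)$ is Lebesgue measurable and $\tilde g(t,\chi_k)\in\partial_{\chi_k}f(t,\chi_k)$ for almost every $t\in[t_k,t_{k+1}]$, where $\partial_{\chi_k}$ is the convex subdifferential in $\chi_k$. Moreover $\tilde g$ is bounded on $[t_k,t_{k+1}]\times\mathcal B$ for every bounded set $\mathcal B\subset\mathbb X$; in particular $\tilde g(\cdot,\chi_k)$ is bounded on the subinterval for each $\chi_k$, and hence it is Lebesgue integrable on $[t_k,t_{k+1}]$. -/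

import Mathlib

open MeasureTheory Set
open scoped Matrix

noncomputable section

namespace FunnelSynthesis

/-- The largest eigenvalue of a symmetric real matrix: the maximum of its (finite) spectrum. -/
def lambdaMax {ι : Type*} [Fintype ι] [DecidableEq ι] (M : Matrix ι ι ℝ) : ℝ :=
  sSup (spectrum ℝ M)

/-- The subdifferential at `x` of a (convex) function on a real inner product space. -/
def subdifferential {X : Type*} [NormedAddCommGroup X] [InnerProductSpace ℝ X]
    (f : X → ℝ) (x : X) : Set X :=
  {g | ∀ y, f x + inner ℝ g (y - x) ≤ f y}

/-- The two forms of the funnel dynamics. -/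
inductive DynamicsType
  /-- `Q' = H₁₁ + H₁₁ᵀ + Z` -/
  | lyapunov
  /-- `Q' = Z` -/
  | direct

/-- The data of a funnel synthesis problem on `[t₀, t_f]`: the linear fractional form
`x' = A_o x + B_o u + F_o w + E φ(t, q_o)`, `q_o = C_o x + D_o u + G_o w`, a nominal trajectory,
the stacked channel selectors, the transformation `T`, the constraint functions, and the scalars
`α`, `c_Q`. -/
structure FunnelData where
  /-- initial time -/
  t0 : ℝ
  /-- final time -/
  tf : ℝ
  /-- state dimension -/
  nx : ℕ
  /-- input dimension -/
  nu : ℕ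
  /-- disturbance dimension -/
  nw : ℕ
  /-- dimension of the argument of the nonlinearity -/
  nqo : ℕ
  /-- dimension of the value of the nonlinearity -/
  np : ℕ
  /-- number of nonlinearity channels -/
  nc : ℕ
  /-- dimension of the argument of each channel -/
  nch : Fin nc → ℕ
  /-- number of state constraints -/
  mx : ℕ
  /-- number of input constraints -/
  mu : ℕ
  Ao : ℝ → Matrix (Fin nx) (Fin nx) ℝ
  Bo : ℝ → Matrix (Fin nx) (Fin nu) ℝ
  Fo : ℝ → Matrix (Fin nx) (Fin nw) ℝ
  E : Matrix (Fin nx) (Fin np) ℝ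
  Co : Matrix (Fin nqo) (Fin nx) ℝ
  Do : Matrix (Fin nqo) (Fin nu) ℝ
  Go : Matrix (Fin nqo) (Fin nw) ℝ
  /-- the nonlinearity `φ(t, q)` -/
  phi : ℝ → EuclideanSpace ℝ (Fin nqo) → EuclideanSpace ℝ (Fin np)
  /-- nominal state trajectory -/
  xbar : ℝ → EuclideanSpace ℝ (Fin nx)
  /-- nominal input trajectory -/
  ubar : ℝ → EuclideanSpace ℝ (Fin nu)
  /-- stacked channel selectors: the rows with first index `i` form `C_i` -/
  C : Matrix ((i : Fin nc) × Fin (nch i)) (Fin nx) ℝ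
  /-- stacked channel selectors: the rows with first index `i` form `D_i` -/
  D : Matrix ((i : Fin nc) × Fin (nch i)) (Fin nu) ℝ
  /-- stacked channel selectors: the rows with first index `i` form `G_i` -/
  G : Matrix ((i : Fin nc) × Fin (nch i)) (Fin nw) ℝ
  T11 : ℝ → Matrix ((i : Fin nc) × Fin (nch i)) ((i : Fin nc) × Fin (nch i)) ℝ
  T12 : ℝ → Matrix ((i : Fin nc) × Fin (nch i)) (Fin np) ℝ
  T21 : ℝ → Matrix (Fin np) ((i : Fin nc) × Fin (nch i)) ℝ
  T22 : ℝ → Matrix (Fin np) (Fin np) ℝ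
  /-- decay rate -/
  alpha : ℝ
  /-- support value of the funnel -/
  cQ : ℝ
  /-- state constraints `h_i(x) ≤ 0` -/
  h : Fin mx → EuclideanSpace ℝ (Fin nx) → ℝ
  /-- input constraints `g_j(u) ≤ 0` -/
  g : Fin mu → EuclideanSpace ℝ (Fin nu) → ℝ

namespace FunnelData

/-- A matrix-valued function that is Lebesgue measurable and bounded on `[a, b]`, entrywise. -/
def MeasurableBounded {m n : Type*} (a b : ℝ) (M : ℝ → Matrix m n ℝ) : Prop :=
  ∀ i j, AEMeasurable (fun t => M t i j) (volume.restrict (Icc a b)) ∧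
    ∃ K, ∀ t ∈ Icc a b, |M t i j| ≤ K

/-- The standing regularity assumptions on the data. (A piecewise continuous `ubar` is measurable
and bounded.) -/
structure Regular (P : FunnelData) : Prop where
  t0_le_tf : P.t0 ≤ P.tf
  Ao_cont : ContinuousOn P.Ao (Icc P.t0 P.tf)
  Bo_cont : ContinuousOn P.Bo (Icc P.t0 P.tf)
  Fo_cont : ContinuousOn P.Fo (Icc P.t0 P.tf)
  phi_diff : ∀ t ∈ Icc P.t0 P.tf, Differentiable ℝ (P.phi t)
  phi_jac_cont : ContinuousOn
    (fun s : ℝ × EuclideanSpace ℝ (Fin P.nqo) => fderiv ℝ (P.phi s.1) s.2)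
    (Icc P.t0 P.tf ×ˢ univ)
  xbar_cont : ContinuousOn P.xbar (Icc P.t0 P.tf)
  ubar_meas : AEMeasurable P.ubar (volume.restrict (Icc P.t0 P.tf))
  ubar_bdd : ∃ K, ∀ t ∈ Icc P.t0 P.tf, ‖P.ubar t‖ ≤ K
  T11_reg : MeasurableBounded P.t0 P.tf P.T11
  T12_reg : MeasurableBounded P.t0 P.tf P.T12
  T21_reg : MeasurableBounded P.t0 P.tf P.T21
  T22_reg : MeasurableBounded P.t0 P.tf P.T22
  T22_nonsing : ∀ t ∈ Icc P.t0 P.tf, IsUnit (P.T22 t).det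
  T22_inv_bdd : ∃ K, ∀ t ∈ Icc P.t0 P.tf, ∀ i j, |(P.T22 t)⁻¹ i j| ≤ K
  h_smooth : ∀ i, ContDiff ℝ 1 (P.h i)
  g_smooth : ∀ j, ContDiff ℝ 1 (P.g j)

variable (P : FunnelData)

/-- Index type of the stacked channel arguments `δq`. -/
abbrev QIdx : Type := (i : Fin P.nc) × Fin (P.nch i)

/-! ### The incremental system -/

/-- The nominal argument of the nonlinearity, `C_o x̄ + D_o ū`. -/
def qbar (t : ℝ) : EuclideanSpace ℝ (Fin P.nqo) :=
  WithLp.toLp 2 (P.Co *ᵥ (P.xbar t).ofLp + P.Do *ᵥ (P.ubar t).ofLp)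

/-- The Jacobian matrix of `φ(t, ·)` at the nominal argument. -/
def phiJac (t : ℝ) : Matrix (Fin P.np) (Fin P.nqo) ℝ :=
  Matrix.of fun i j => (fderiv ℝ (P.phi t) (P.qbar t) (EuclideanSpace.single j 1)) i

def A (t : ℝ) : Matrix (Fin P.nx) (Fin P.nx) ℝ := P.Ao t + P.E * P.phiJac t * P.Co

def B (t : ℝ) : Matrix (Fin P.nx) (Fin P.nu) ℝ := P.Bo t + P.E * P.phiJac t * P.Do

def F (t : ℝ) : Matrix (Fin P.nx) (Fin P.nw) ℝ := P.Fo t + P.E * P.phiJac t * P.Go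

def Lam (t : ℝ) : Matrix P.QIdx (Fin P.np) ℝ := P.T12 t * (P.T22 t)⁻¹

def Sig (t : ℝ) : Matrix P.QIdx P.QIdx ℝ := P.T11 t - P.T12 t * (P.T22 t)⁻¹ * P.T21 t

/-! ### Decision variables -/

/-- Coordinates of `ζ_v`: the entries of `Y`, `Z`, `N₁`, `N₂`, then `λ_w`, then `s`. -/
abbrev InputIdx : Type :=
  (Fin P.nu × Fin P.nx) ⊕ (Fin P.nx × Fin P.nx) ⊕ (P.QIdx × P.QIdx) ⊕ (Fin P.np × Fin P.np) ⊕
    Unit ⊕ Fin P.nc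

/-- The vectors `ζ_v`. -/
abbrev InputVec : Type := P.InputIdx → ℝ

variable {P}

def Y (z : P.InputVec) : Matrix (Fin P.nu) (Fin P.nx) ℝ :=
  Matrix.of fun i j => z (.inl (i, j))

def Z (z : P.InputVec) : Matrix (Fin P.nx) (Fin P.nx) ℝ :=
  Matrix.of fun i j => z (.inr (.inl (i, j)))

def N1 (z : P.InputVec) : Matrix P.QIdx P.QIdx ℝ :=
  Matrix.of fun i j => z (.inr (.inr (.inl (i, j))))

def N2 (z : P.InputVec) : Matrix (Fin P.np) (Fin P.np) ℝ :=
  Matrix.of fun i j => z (.inr (.inr (.inr (.inl (i, j)))))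

def lamW (z : P.InputVec) : ℝ := z (.inr (.inr (.inr (.inr (.inl ())))))

def sVar (z : P.InputVec) (i : Fin P.nc) : ℝ := z (.inr (.inr (.inr (.inr (.inr i)))))

variable (P)

/-- Coordinates of `χ_k = (q_{v,k}, ζ_{v,k}^m, ζ_{v,k+1}^p)`. -/
abbrev ChiIdx : Type := (Fin P.nx × Fin P.nx) ⊕ P.InputIdx ⊕ P.InputIdx

variable {P}

/-- `Q_k` -/
def Qnode (c : EuclideanSpace ℝ P.ChiIdx) : Matrix (Fin P.nx) (Fin P.nx) ℝ :=
  Matrix.of fun i j => c (.inl (i, j))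

/-- `ζ_k^m` -/
def zetaM (c : EuclideanSpace ℝ P.ChiIdx) : P.InputVec := fun i => c (.inr (.inl i))

/-- `ζ_{k+1}^p` -/
def zetaP (c : EuclideanSpace ℝ P.ChiIdx) : P.InputVec := fun i => c (.inr (.inr i))

/-- The matrix variables `Z`, `N₁`, `N₂` in `ζ_v` are symmetric. -/
def SymmInput (z : P.InputVec) : Prop := (Z z).IsSymm ∧ (N1 z).IsSymm ∧ (N2 z).IsSymm

variable (P)

/-- The space in which `χ_k` lives: `Q_k` and the `Z`, `N₁`, `N₂` parts are symmetric matrices.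
It carries the Euclidean inner product of the vectorized variables. -/
def decisionSpace : Submodule ℝ (EuclideanSpace ℝ P.ChiIdx) where
  carrier := {c | (Qnode c).IsSymm ∧ SymmInput (zetaM c) ∧ SymmInput (zetaP c)}
  zero_mem' := by
    refine ⟨?_, ⟨?_, ?_, ?_⟩, ?_, ?_, ?_⟩ <;> · ext i j; rfl
  add_mem' := by
    rintro a b ⟨ha, ⟨ha1, ha2, ha3⟩, ha4, ha5, ha6⟩ ⟨hb, ⟨hb1, hb2, hb3⟩, hb4, hb5, hb6⟩
    exact ⟨ha.add hb, ⟨ha1.add hb1, ha2.add hb2, ha3.add hb3⟩,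
      ha4.add hb4, ha5.add hb5, ha6.add hb6⟩
  smul_mem' := by
    rintro r a ⟨ha, ⟨ha1, ha2, ha3⟩, ha4, ha5, ha6⟩
    exact ⟨ha.smul r, ⟨ha1.smul r, ha2.smul r, ha3.smul r⟩,
      ha4.smul r, ha5.smul r, ha6.smul r⟩

/-! ### Mesh, first-order hold and funnel dynamics -/

/-- The node `t_k` of the uniform mesh with `N` subintervals. -/
def node (N k : ℕ) : ℝ := P.t0 + (k : ℝ) / (N : ℝ) * (P.tf - P.t0)

variable {P}

/-- First-order hold interpolation on `[a, b]`. -/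
def foh (a b : ℝ) (zm zp : P.InputVec) (t : ℝ) : P.InputVec :=
  ((b - t) / (b - a)) • zm + ((t - a) / (b - a)) • zp

variable (P)

def H11 (t : ℝ) (Q : Matrix (Fin P.nx) (Fin P.nx) ℝ) (z : P.InputVec) :
    Matrix (Fin P.nx) (Fin P.nx) ℝ :=
  P.A t * Q + P.B t * Y z - P.E * (P.T22 t)⁻¹ * P.T21 t * (P.C * Q + P.D * Y z) +
    (P.alpha / 2) • Q

/-- Right-hand side of the funnel dynamics. -/
def dynRHS (ty : DynamicsType) (t : ℝ) (Q : Matrix (Fin P.nx) (Fin P.nx) ℝ) (z : P.InputVec) :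
    Matrix (Fin P.nx) (Fin P.nx) ℝ :=
  match ty with
  | .lyapunov => P.H11 t Q z + (P.H11 t Q z)ᵀ + Z z
  | .direct => Z z

variable {P}

/-- `Q(·)` is the solution on `[a, b]` of the funnel dynamics that starts at `Q_k` and is driven by
the first-order hold of the inputs in `c`. -/
def IsFunnelState (ty : DynamicsType) (a b : ℝ) (c : EuclideanSpace ℝ P.ChiIdx)
    (Q : ℝ → Matrix (Fin P.nx) (Fin P.nx) ℝ) : Prop :=
  ContinuousOn Q (Icc a b) ∧
  ∀ t ∈ Icc a b, ∀ i j, Q t i j = Qnode c i j +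
    ∫ r in a..t, P.dynRHS ty r (Q r) (foh a b (zetaM c) (zetaP c) r) i j

/-! ### The pointwise-in-time linear matrix inequalities `L_l(t, Q, ζ) ⪯ 0` -/

variable (P)

def H12 (t : ℝ) (Q : Matrix (Fin P.nx) (Fin P.nx) ℝ) (z : P.InputVec) :
    Matrix (Fin P.np ⊕ (Fin P.nw ⊕ P.QIdx)) (Fin P.nx) ℝ :=
  Matrix.fromRows (N2 z * ((P.T22 t)⁻¹)ᵀ * P.Eᵀ)
    (Matrix.fromRows
      ((P.F t)ᵀ - P.Gᵀ * (P.T21 t)ᵀ * ((P.T22 t)⁻¹)ᵀ * P.Eᵀ)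
      (P.Sig t * (P.C * Q + P.D * Y z)))

def H22 (t : ℝ) (z : P.InputVec) :
    Matrix (Fin P.np ⊕ (Fin P.nw ⊕ P.QIdx)) (Fin P.np ⊕ (Fin P.nw ⊕ P.QIdx)) ℝ :=
  Matrix.fromBlocks (-N2 z) (Matrix.fromRows 0 (P.Lam t * N2 z))ᵀ
    (Matrix.fromRows 0 (P.Lam t * N2 z))
    (Matrix.fromBlocks (-(lamW z • (1 : Matrix (Fin P.nw) (Fin P.nw) ℝ))) (P.Sig t * P.G)ᵀ
      (P.Sig t * P.G) (-N1 z))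

/-- The upper left block of the invariance condition. -/
def invBlock (ty : DynamicsType) (t : ℝ) (Q : Matrix (Fin P.nx) (Fin P.nx) ℝ)
    (z : P.InputVec) : Matrix (Fin P.nx) (Fin P.nx) ℝ :=
  match ty with
  | .lyapunov => -Z z
  | .direct => P.H11 t Q z + (P.H11 t Q z)ᵀ - Z z

/-- The invariance condition is `invLMI ⪯ 0`. -/
def invLMI (ty : DynamicsType) (t : ℝ) (Q : Matrix (Fin P.nx) (Fin P.nx) ℝ) (z : P.InputVec) :
    Matrix (Fin P.nx ⊕ (Fin P.np ⊕ (Fin P.nw ⊕ P.QIdx)))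
      (Fin P.nx ⊕ (Fin P.np ⊕ (Fin P.nw ⊕ P.QIdx))) ℝ :=
  Matrix.fromBlocks (P.invBlock ty t Q z) (P.H12 t Q z)ᵀ (P.H12 t Q z) (P.H22 t z)

/-- `a_i^h(t)`, the normal of the linearized state constraint. -/
def ah (i : Fin P.mx) (t : ℝ) : EuclideanSpace ℝ (Fin P.nx) := gradient (P.h i) (P.xbar t)

/-- `b_i^h(t)`, the offset of the linearized state constraint. -/
def bh (i : Fin P.mx) (t : ℝ) : ℝ := inner ℝ (P.ah i t) (P.xbar t) - P.h i (P.xbar t)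

/-- `a_j^g(t)`, the normal of the linearized input constraint. -/
def ag (j : Fin P.mu) (t : ℝ) : EuclideanSpace ℝ (Fin P.nu) := gradient (P.g j) (P.ubar t)

/-- `b_j^g(t)`, the offset of the linearized input constraint. -/
def bg (j : Fin P.mu) (t : ℝ) : ℝ := inner ℝ (P.ag j t) (P.ubar t) - P.g j (P.ubar t)

/-- The state constraint is `stateLMI ⪯ 0`. -/
def stateLMI (i : Fin P.mx) (t : ℝ) (Q : Matrix (Fin P.nx) (Fin P.nx) ℝ) :
    Matrix (Unit ⊕ Fin P.nx) (Unit ⊕ Fin P.nx) ℝ :=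
  -Matrix.fromBlocks
    (Matrix.of fun _ _ => (P.bh i t - inner ℝ (P.ah i t) (P.xbar t)) ^ 2)
    (Matrix.replicateRow Unit (P.cQ • ((P.ah i t).ofLp ᵥ* Q)))
    (Matrix.replicateCol Unit (P.cQ • (Q *ᵥ (P.ah i t).ofLp)))
    (P.cQ • Q)

/-- The input constraint is `inputLMI ⪯ 0`. -/
def inputLMI (j : Fin P.mu) (t : ℝ) (Q : Matrix (Fin P.nx) (Fin P.nx) ℝ) (z : P.InputVec) :
    Matrix (Unit ⊕ Fin P.nx) (Unit ⊕ Fin P.nx) ℝ :=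
  -Matrix.fromBlocks
    (Matrix.of fun _ _ => (P.bg j t - inner ℝ (P.ag j t) (P.ubar t)) ^ 2)
    (Matrix.replicateRow Unit (P.cQ • ((P.ag j t).ofLp ᵥ* Y z)))
    (Matrix.replicateCol Unit (P.cQ • ((Y z)ᵀ *ᵥ (P.ag j t).ofLp)))
    (P.cQ • Q)

/-- `C_i Q + D_i Y` for channel `i`. -/
def channel (i : Fin P.nc) (Q : Matrix (Fin P.nx) (Fin P.nx) ℝ) (z : P.InputVec) :
    Matrix (Fin (P.nch i)) (Fin P.nx) ℝ :=
  (P.C * Q + P.D * Y z).submatrix (fun r => ⟨i, r⟩) id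

/-- The validity of the multiplier of an L-smooth nonlinearity is `smoothLMI ⪯ 0`. -/
def smoothLMI (i : Fin P.nc) (Q : Matrix (Fin P.nx) (Fin P.nx) ℝ) (z : P.InputVec) :
    Matrix (Fin (P.nch i) ⊕ Fin P.nx) (Fin (P.nch i) ⊕ Fin P.nx) ℝ :=
  -Matrix.fromBlocks (sVar z i • (1 : Matrix (Fin (P.nch i)) (Fin (P.nch i)) ℝ))
    (P.channel i Q z) (P.channel i Q z)ᵀ Q

/-- The index `l` of the constraints `L_l ⪯ 0`. -/
inductive LMIIdx
  | invariance
  | state (i : Fin P.mx)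
  | input (j : Fin P.mu)
  | smooth (i : Fin P.nc)

/-- `λ_max(L_l(t, Q, ζ))`. -/
def lmiMax (ty : DynamicsType) (l : P.LMIIdx) (t : ℝ) (Q : Matrix (Fin P.nx) (Fin P.nx) ℝ)
    (z : P.InputVec) : ℝ :=
  match l with
  | .invariance => lambdaMax (P.invLMI ty t Q z)
  | .state i => lambdaMax (P.stateLMI i t Q)
  | .input j => lambdaMax (P.inputLMI j t Q z)
  | .smooth i => lambdaMax (P.smoothLMI i Q z)

variable {P}

/-- The integrand `max(0, λ_max(L_l(t, χ)))^p` on the subinterval `[a, b]`, where `Q c` is the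
funnel state generated by the decision variable `c`. -/
def violation (ty : DynamicsType) (l : P.LMIIdx) (p a b : ℝ)
    (Q : P.decisionSpace → ℝ → Matrix (Fin P.nx) (Fin P.nx) ℝ) (t : ℝ) (c : P.decisionSpace) : ℝ :=
  (max 0 (P.lmiMax ty l t (Q c t) (foh a b (zetaM c.1) (zetaP c.1) t))) ^ p

end FunnelData

end FunnelSynthesis

end

/-! The integrand is a fixed convex function of a symmetric matrix, `M ↦ max 0 (lambdaMax M) ^ p`,
composed with a family of matrices that is affine in the decision variable and measurable and
bounded in time. So one Borel selection of subgradients of the fixed function is enough: composed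
with the family and pulled back by the adjoint of its linear part, it is measurable in time, and no
measurable selection theorem is needed.

For the largest eigenvalue such a selection is the orthogonal projection onto the top eigenspace
divided by its trace. It is the limit of `Sⁿ / tr Sⁿ`, where `S` is a positive definite shift of
`M`, and hence Borel (`topProj`); it is a convex combination of `u uᵀ` over unit eigenvectors `u`
for the largest eigenvalue, so that the Rayleigh bound gives `⟪topProj M, N⟫ ≤ lambdaMax N` with
equality at `N = M` (`sum_topProj_mul_le`, `sum_topProj_mul_self`). The tangent line inequality for
`max 0 · ^ p` and the chain rule then give `exists_measurable_subgradient`.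

The family is affine since the funnel state depends linearly on the decision variable: the
dynamics are linear with bounded measurable coefficients, and the defect of linearity solves the
homogeneous equation with zero initial value, hence vanishes by Grönwall's inequality
(`Regular.funnelState_add_smul`). The coefficients are measurable and bounded because the Jacobian
of the nonlinearity and the gradients of the constraints are continuous and are evaluated along a
measurable bounded nominal trajectory (`BddMeas.comp_of_continuousOn`), and because the inverse of
`T22` is measurable by Cramer's rule.
-/

namespace FunnelSynthesis

/-! ### The largest eigenvalue of a symmetric matrix and a Borel subgradient of it -/

section LambdaMax

open Filter Topology

variable {ι : Type*} [Fintype ι] [DecidableEq ι]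

lemma exists_orthogonal_diagonalization {M : Matrix ι ι ℝ} (hM : M.IsSymm) :
    ∃ (U : Matrix ι ι ℝ) (lam : ι → ℝ), Uᵀ * U = 1 ∧ U * Uᵀ = 1 ∧
      M = U * Matrix.diagonal lam * Uᵀ ∧ spectrum ℝ M = range lam := by
  have hH : M.IsHermitian := by
    rw [Matrix.IsHermitian, Matrix.conjTranspose_eq_transpose_of_trivial]
    exact hM
  have hstar : star (hH.eigenvectorUnitary : Matrix ι ι ℝ)
      = (hH.eigenvectorUnitary : Matrix ι ι ℝ)ᵀ := by
    rw [Matrix.star_eq_conjTranspose, Matrix.conjTranspose_eq_transpose_of_trivial]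
  refine ⟨hH.eigenvectorUnitary, hH.eigenvalues, ?_, ?_, ?_,
    hH.spectrum_real_eq_range_eigenvalues⟩
  · rw [← hstar]
    exact Unitary.coe_star_mul_self _
  · rw [← hstar]
    exact Unitary.coe_mul_star_self _
  · have h := hH.spectral_theorem
    rw [Unitary.conjStarAlgAut_apply, hstar] at h
    exact h

lemma abs_apply_le_one_of_mul_transpose {U : Matrix ι ι ℝ} (hU : U * Uᵀ = 1) (i j : ι) :
    |U i j| ≤ 1 := by
  refine entry_norm_bound_of_unitary (𝕜 := ℝ) (U := U) ?_ i j
  rw [Matrix.mem_unitaryGroup_iff, Matrix.star_eq_conjTranspose,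
    Matrix.conjTranspose_eq_transpose_of_trivial]
  exact hU

lemma mul_diagonal_mul_transpose_apply (U : Matrix ι ι ℝ) (lam : ι → ℝ) (i j : ι) :
    (U * Matrix.diagonal lam * Uᵀ) i j = ∑ k, lam k * (U i k * U j k) := by
  rw [Matrix.mul_apply]
  refine Finset.sum_congr rfl fun k _ => ?_
  rw [Matrix.mul_diagonal, Matrix.transpose_apply]
  ring

/-- The Rayleigh quotient bound. -/
lemma dotProduct_mulVec_le_lambdaMax {M : Matrix ι ι ℝ} (hM : M.IsSymm) (v : ι → ℝ) :
    v ⬝ᵥ (M *ᵥ v) ≤ lambdaMax M * (v ⬝ᵥ v) := by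
  obtain ⟨U, lam, -, hUU, hMU, hspec⟩ := exists_orthogonal_diagonalization hM
  have hle : ∀ k, lam k ≤ lambdaMax M := fun k => by
    unfold lambdaMax
    rw [hspec]
    exact le_csSup (finite_range lam).bddAbove (mem_range_self k)
  have h1 : v ⬝ᵥ (M *ᵥ v) = ∑ k, lam k * ((Uᵀ *ᵥ v) k * (Uᵀ *ᵥ v) k) := by
    rw [hMU, ← Matrix.mulVec_mulVec, ← Matrix.mulVec_mulVec, Matrix.dotProduct_mulVec,
      ← Matrix.mulVec_transpose, dotProduct]
    refine Finset.sum_congr rfl fun k _ => ?_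
    rw [Matrix.mulVec_diagonal]
    ring
  have h2 : v ⬝ᵥ v = ∑ k, (Uᵀ *ᵥ v) k * (Uᵀ *ᵥ v) k := by
    have : v ⬝ᵥ v = v ⬝ᵥ ((U * Uᵀ) *ᵥ v) := by rw [hUU, Matrix.one_mulVec]
    rw [this, ← Matrix.mulVec_mulVec, Matrix.dotProduct_mulVec, ← Matrix.mulVec_transpose,
      dotProduct]
  rw [h1, h2, Finset.mul_sum]
  exact Finset.sum_le_sum fun k _ => mul_le_mul_of_nonneg_right (hle k) (mul_self_nonneg _)

/-- The matrix `M + c I` with `c = 1 + ∑ |M i j|`, which is positive definite when `M` is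
symmetric. -/
noncomputable def posShift (M : Matrix ι ι ℝ) : Matrix ι ι ℝ := M + (1 + ∑ i, ∑ j, |M i j|) • 1

/-- A Borel subgradient of `lambdaMax` on symmetric matrices. With `S` the positive definite
shift of `M`, the normalized powers `Sⁿ / tr Sⁿ` converge to the orthogonal projection onto the
top eigenspace of `M`, divided by its trace. The entrywise `limsup` is the limit for symmetric
`M`, and makes Borel measurability automatic. -/
noncomputable def topProj (M : Matrix ι ι ℝ) : Matrix ι ι ℝ :=
  Matrix.of fun i j => limsup (fun n : ℕ => (posShift M ^ n) i j / (posShift M ^ n).trace) atTop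

lemma measurable_topProj_apply (i j : ι) :
    Measurable fun M : ι → ι → ℝ => topProj (Matrix.of M) i j := by
  have hcont : Continuous fun M : ι → ι → ℝ => posShift (Matrix.of M) := by
    unfold posShift
    have h1 : Continuous fun M : ι → ι → ℝ => (Matrix.of M : Matrix ι ι ℝ) := continuous_id
    refine h1.add (Continuous.smul (f := fun M : ι → ι → ℝ => 1 + ∑ i, ∑ j, |Matrix.of M i j|) ?_
      continuous_const)
    refine continuous_const.add (continuous_finsetSum _ fun a _ =>
      continuous_finsetSum _ fun b _ => ?_)
    exact (h1.matrix_elem a b).abs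
  unfold topProj
  simp only [Matrix.of_apply]
  refine Measurable.limsup fun n => ?_
  exact ((hcont.pow n).matrix_elem i j).measurable.div (hcont.pow n).matrix_trace.measurable

omit [DecidableEq ι] in
/-- Normalized powers of positive numbers converge to weights carried by the maximal ones. -/
lemma exists_tendsto_pow_div_sum [Nonempty ι] (mu : ι → ℝ) (hmu : ∀ i, 0 < mu i) :
    ∃ w : ι → ℝ, (∀ i, Tendsto (fun n : ℕ => mu i ^ n / ∑ j, mu j ^ n) atTop (𝓝 (w i))) ∧
      (∀ i, 0 ≤ w i) ∧ ∑ i, w i = 1 ∧ ∀ i, w i ≠ 0 → ∀ j, mu j ≤ mu i := by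
  obtain ⟨m, hm⟩ := Finite.exists_max mu
  -- Numerator and denominator are divided by the power of the largest number.
  have hlim : ∀ i, Tendsto (fun n : ℕ => (mu i / mu m) ^ n) atTop
      (𝓝 (if mu i = mu m then 1 else 0)) := by
    intro i
    split_ifs with h
    · simp [h, div_self (hmu m).ne']
    · exact tendsto_pow_atTop_nhds_zero_of_lt_one (div_pos (hmu i) (hmu m)).le
        ((div_lt_one (hmu m)).2 (lt_of_le_of_ne (hm i) h))
  set e : ι → ℝ := fun i => if mu i = mu m then 1 else 0 with he
  have he0 : ∀ i, 0 ≤ e i := fun i => by simp only [he]; split_ifs <;> norm_num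
  have hepos : 0 < ∑ j, e j :=
    Finset.sum_pos' (fun i _ => he0 i) ⟨m, Finset.mem_univ _, by simp [he]⟩
  refine ⟨fun i => e i / ∑ j, e j, fun i => ?_, fun i => div_nonneg (he0 i) hepos.le, ?_, ?_⟩
  · have h := (hlim i).div (tendsto_finsetSum Finset.univ fun j _ => hlim j) hepos.ne'
    refine h.congr fun n => ?_
    have hp : mu m ^ n ≠ 0 := (pow_pos (hmu m) n).ne'
    simp only [div_pow, Pi.div_apply]
    rw [← Finset.sum_div, div_div_div_cancel_right₀ hp]
  · rw [← Finset.sum_div, div_self hepos.ne']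
  · intro i hi j
    by_cases h : mu i = mu m
    · rw [h]; exact hm j
    · exact absurd (by simp [he, h]) hi

/-- On symmetric matrices `topProj` is a convex combination of rank one projections `u uᵀ` onto
unit eigenvectors for the largest eigenvalue. -/
lemma exists_topProj_eq [Nonempty ι] {M : Matrix ι ι ℝ} (hM : M.IsSymm) :
    ∃ (U : Matrix ι ι ℝ) (lam w : ι → ℝ), Uᵀ * U = 1 ∧ U * Uᵀ = 1 ∧
      M = U * Matrix.diagonal lam * Uᵀ ∧
      (∀ i, 0 ≤ w i) ∧ ∑ i, w i = 1 ∧ (∀ k, w k ≠ 0 → lam k = lambdaMax M) ∧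
      ∀ i j, topProj M i j = ∑ k, w k * (U i k * U j k) := by
  obtain ⟨U, lam, hU, hUU, hMU, hspec⟩ := exists_orthogonal_diagonalization hM
  set c : ℝ := 1 + ∑ i, ∑ j, |M i j| with hc
  have hentry : ∀ i k, |U i k| ≤ 1 := abs_apply_le_one_of_mul_transpose hUU
  have hlam : ∀ k, lam k = ∑ i, ∑ j, U i k * M i j * U j k := fun k => by
    have h : Matrix.diagonal lam = Uᵀ * M * U := by
      rw [hMU]
      calc Matrix.diagonal lam = (Uᵀ * U) * Matrix.diagonal lam * (Uᵀ * U) := by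
            rw [hU, Matrix.one_mul, Matrix.mul_one]
        _ = _ := by simp only [Matrix.mul_assoc]
    have h2 := congrFun (congrFun h k) k
    rw [Matrix.diagonal_apply_eq, Matrix.mul_apply] at h2
    rw [h2, Finset.sum_comm]
    refine Finset.sum_congr rfl fun j _ => ?_
    rw [Matrix.mul_apply, Finset.sum_mul]
    rfl
  have hpos : ∀ k, 0 < lam k + c := fun k => by
    have h1 : |lam k| ≤ ∑ i, ∑ j, |M i j| := by
      rw [hlam k]
      refine (Finset.abs_sum_le_sum_abs _ _).trans (Finset.sum_le_sum fun i _ => ?_)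
      refine (Finset.abs_sum_le_sum_abs _ _).trans (Finset.sum_le_sum fun j _ => ?_)
      rw [abs_mul, abs_mul]
      calc |U i k| * |M i j| * |U j k| ≤ 1 * |M i j| * 1 := by
            gcongr
            · exact hentry i k
            · exact hentry j k
        _ = |M i j| := by ring
    have h2 := neg_abs_le (lam k)
    rw [hc]
    linarith
  have hpow : ∀ n : ℕ, posShift M ^ n
      = U * Matrix.diagonal (fun k => (lam k + c) ^ n) * Uᵀ := by
    intro n
    have hshift : posShift M = U * Matrix.diagonal (fun k => lam k + c) * Uᵀ := by
      have hd : Matrix.diagonal (fun k => lam k + c)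
          = Matrix.diagonal lam + c • (1 : Matrix ι ι ℝ) := by
        rw [Matrix.smul_one_eq_diagonal, Matrix.diagonal_add]
      rw [hd, Matrix.mul_add, Matrix.add_mul, ← hMU, Matrix.mul_smul, Matrix.mul_one,
        Matrix.smul_mul, hUU]
      rfl
    induction n with
    | zero => simp [hUU]
    | succ n ih =>
      rw [pow_succ, ih, hshift]
      calc U * Matrix.diagonal (fun k => (lam k + c) ^ n) * Uᵀ
            * (U * Matrix.diagonal (fun k => lam k + c) * Uᵀ)
          = U * (Matrix.diagonal (fun k => (lam k + c) ^ n) * (Uᵀ * U)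
            * Matrix.diagonal (fun k => lam k + c)) * Uᵀ := by simp only [Matrix.mul_assoc]
        _ = _ := by
            rw [hU, Matrix.mul_one, Matrix.diagonal_mul_diagonal]
            simp only [pow_succ]
  have htr : ∀ n : ℕ, (posShift M ^ n).trace = ∑ k, (lam k + c) ^ n := fun n => by
    rw [hpow, Matrix.mul_assoc, Matrix.trace_mul_comm, Matrix.mul_assoc, hU, Matrix.mul_one,
      Matrix.trace_diagonal]
  obtain ⟨w, hw, hw0, hw1, hwmax⟩ := exists_tendsto_pow_div_sum (fun k => lam k + c) hpos
  refine ⟨U, lam, w, hU, hUU, hMU, hw0, hw1, fun k hk => ?_, fun i j => ?_⟩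
  · have hmax : ∀ j, lam j ≤ lam k := fun j => by simpa using hwmax k hk j
    unfold lambdaMax
    rw [hspec]
    exact le_antisymm (le_csSup (finite_range lam).bddAbove (mem_range_self k))
      (csSup_le (range_nonempty lam) (by rintro _ ⟨j, rfl⟩; exact hmax j))
  · have ht : Tendsto (fun n : ℕ => (posShift M ^ n) i j / (posShift M ^ n).trace) atTop
        (𝓝 (∑ k, w k * (U i k * U j k))) := by
      refine (tendsto_finsetSum Finset.univ fun k _ =>
        (hw k).mul_const (U i k * U j k)).congr fun n => ?_
      rw [htr, hpow, mul_diagonal_mul_transpose_apply, Finset.sum_div]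
      exact Finset.sum_congr rfl fun k _ => by ring
    exact ht.limsup_eq

lemma abs_topProj_apply_le_one {M : Matrix ι ι ℝ} (hM : M.IsSymm) (i j : ι) :
    |topProj M i j| ≤ 1 := by
  have : Nonempty ι := ⟨i⟩
  obtain ⟨U, lam, w, -, hUU, -, hw0, hw1, -, h⟩ := exists_topProj_eq hM
  have hentry : ∀ i k, |U i k| ≤ 1 := abs_apply_le_one_of_mul_transpose hUU
  rw [h, ← hw1]
  refine (Finset.abs_sum_le_sum_abs _ _).trans (Finset.sum_le_sum fun k _ => ?_)
  rw [abs_mul, abs_mul, abs_of_nonneg (hw0 k)]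
  exact mul_le_of_le_one_right (hw0 k)
    (mul_le_one₀ (hentry i k) (abs_nonneg _) (hentry j k))

lemma sum_topProj_mul_le {M N : Matrix ι ι ℝ} (hM : M.IsSymm) (hN : N.IsSymm) :
    ∑ i, ∑ j, topProj M i j * N i j ≤ lambdaMax N := by
  rcases isEmpty_or_nonempty ι with hι | hι
  -- The spectrum of the empty matrix is empty, so that its `lambdaMax` is `0`.
  · simp [lambdaMax]
  obtain ⟨U, lam, w, hU, -, -, hw0, hw1, -, h⟩ := exists_topProj_eq hM
  calc ∑ i, ∑ j, topProj M i j * N i j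
      = ∑ k, w k * ((fun i => U i k) ⬝ᵥ (N *ᵥ fun i => U i k)) := by
        simp only [h, dotProduct, Matrix.mulVec, Finset.mul_sum, Finset.sum_mul]
        rw [Finset.sum_comm' (t' := Finset.univ) (s' := fun _ => Finset.univ) (by simp)]
        refine Eq.trans (Finset.sum_congr rfl fun j _ => Finset.sum_comm) ?_
        rw [Finset.sum_comm]
        refine Finset.sum_congr rfl fun k _ => ?_
        rw [Finset.sum_comm]
        exact Finset.sum_congr rfl fun i _ => Finset.sum_congr rfl fun j _ => by ring
    _ ≤ ∑ k, w k * lambdaMax N := by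
        refine Finset.sum_le_sum fun k _ => mul_le_mul_of_nonneg_left ?_ (hw0 k)
        have h1 := dotProduct_mulVec_le_lambdaMax hN fun i => U i k
        have h2 : ((fun i => U i k) ⬝ᵥ fun i => U i k) = 1 := by
          have := congrFun (congrFun hU k) k
          rwa [Matrix.mul_apply, Matrix.one_apply_eq] at this
        rwa [h2, mul_one] at h1
    _ = lambdaMax N := by rw [← Finset.sum_mul, hw1, one_mul]

lemma sum_topProj_mul_self {M : Matrix ι ι ℝ} (hM : M.IsSymm) :
    ∑ i, ∑ j, topProj M i j * M i j = lambdaMax M := by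
  refine le_antisymm (sum_topProj_mul_le hM hM) ?_
  rcases isEmpty_or_nonempty ι with hι | hι
  · simp [lambdaMax]
  obtain ⟨U, lam, w, hU, -, hMU, hw0, hw1, hmax, h⟩ := exists_topProj_eq hM
  have hquad : ∀ k, ∑ i, ∑ j, (U i k * U j k) * M i j = lam k := fun k => by
    have hd : Uᵀ * M * U = Matrix.diagonal lam := by
      rw [hMU]
      calc _ = (Uᵀ * U) * Matrix.diagonal lam * (Uᵀ * U) := by simp only [Matrix.mul_assoc]
        _ = _ := by rw [hU, Matrix.one_mul, Matrix.mul_one]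
    have h2 := congrFun (congrFun hd k) k
    rw [Matrix.diagonal_apply_eq, Matrix.mul_apply] at h2
    rw [← h2, Finset.sum_comm]
    refine Finset.sum_congr rfl fun j _ => ?_
    rw [Matrix.mul_apply, Finset.sum_mul]
    exact Finset.sum_congr rfl fun i _ => by rw [Matrix.transpose_apply]; ring
  refine le_of_eq ?_
  calc lambdaMax M = ∑ k, w k * lambdaMax M := by rw [← Finset.sum_mul, hw1, one_mul]
    _ = ∑ k, w k * lam k := by
        refine Finset.sum_congr rfl fun k _ => ?_
        by_cases hk : w k = 0
        · simp [hk]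
        · rw [hmax k hk]
    _ = ∑ k, ∑ i, ∑ j, w k * (U i k * U j k) * M i j := by
        refine Finset.sum_congr rfl fun k _ => ?_
        rw [← hquad k, Finset.mul_sum]
        refine Finset.sum_congr rfl fun i _ => ?_
        rw [Finset.mul_sum]
        exact Finset.sum_congr rfl fun j _ => by ring
    _ = ∑ i, ∑ j, topProj M i j * M i j := by
        rw [Finset.sum_comm]
        refine Finset.sum_congr rfl fun i _ => ?_
        rw [Finset.sum_comm]
        exact Finset.sum_congr rfl fun j _ => by rw [h, Finset.sum_mul]

end LambdaMax

/-! ### Powers of the positive part -/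

/-- The slope at `s` of the convex function `max 0 · ^ p`. The value at `s ≤ 0` is set by hand:
for `p = 1` the expression `0 ^ (p - 1)` is `1`, and negative bases have no meaning. -/
noncomputable def posPowSlope (p s : ℝ) : ℝ := if s ≤ 0 then 0 else p * s ^ (p - 1)

lemma posPowSlope_nonneg {p : ℝ} (hp : 1 ≤ p) (s : ℝ) : 0 ≤ posPowSlope p s := by
  unfold posPowSlope
  split_ifs with h
  · exact le_rfl
  · have := not_le.1 h
    positivity

lemma posPowSlope_le {p s B : ℝ} (hp : 1 ≤ p) (hB : 0 ≤ B) (hs : s ≤ B) :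
    posPowSlope p s ≤ p * B ^ (p - 1) := by
  unfold posPowSlope
  split_ifs with h
  · positivity
  · exact mul_le_mul_of_nonneg_left
      (Real.rpow_le_rpow (not_le.1 h).le hs (by linarith)) (by linarith)

lemma measurable_posPowSlope (p : ℝ) : Measurable (posPowSlope p) :=
  Measurable.ite measurableSet_Iic measurable_const
    ((measurable_id.pow_const (p - 1)).const_mul p)

/-- The tangent line inequality for `max 0 · ^ p`. -/
lemma posPow_add_slope_mul_le {p : ℝ} (hp : 1 ≤ p) (s r : ℝ) :
    max 0 s ^ p + posPowSlope p s * (r - s) ≤ max 0 r ^ p := by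
  unfold posPowSlope
  split_ifs with h
  · rw [max_eq_left h, Real.zero_rpow (by linarith), zero_mul, add_zero]
    exact Real.rpow_nonneg (le_max_left _ _) _
  · have hs : 0 < s := not_le.1 h
    have hsp : s ^ p = s * s ^ (p - 1) := by
      rw [← Real.rpow_one_add' hs.le (by linarith)]
      congr 1
      ring
    have hq : 0 ≤ s ^ (p - 1) := by positivity
    rw [max_eq_right hs.le]
    rcases le_total 0 r with hr | hr
    · rw [max_eq_right hr]
      -- Bernoulli's inequality for `r / s = 1 + (r / s - 1)`.
      have hb := one_add_mul_self_le_rpow_one_add (s := r / s - 1)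
        (by linarith [div_nonneg hr hs.le]) hp
      rw [add_sub_cancel, Real.div_rpow hr hs.le, le_div_iff₀ (by positivity)] at hb
      refine le_trans (le_of_eq ?_) hb
      rw [hsp]
      field_simp
    · rw [max_eq_left hr, Real.zero_rpow (by linarith), hsp]
      nlinarith [mul_nonneg hq hs.le, mul_nonneg (mul_nonneg hq (by linarith : 0 ≤ p))
        (neg_nonneg.2 hr), mul_nonneg (mul_nonneg hq hs.le) (sub_nonneg.2 hp)]

/-! ### Subgradient selection for affine families of symmetric matrices -/

lemma FunnelData.MeasurableBounded.exists_bound {m n : Type*} [Finite m] [Finite n] {a b : ℝ}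
    {M : ℝ → Matrix m n ℝ} (hM : FunnelData.MeasurableBounded a b M) :
    ∃ K, ∀ t ∈ Icc a b, ∀ i j, |M t i j| ≤ K := by
  choose K hK using fun i j => (hM i j).2
  obtain ⟨B, hB⟩ := Finite.exists_le fun q : m × n => K q.1 q.2
  exact ⟨B, fun t ht i j => (hK i j t ht).trans (hB (i, j))⟩

section Selection

variable {X : Type*} [NormedAddCommGroup X] [InnerProductSpace ℝ X]
  {ι : Type*} [Fintype ι] [DecidableEq ι]

omit [Fintype ι] [DecidableEq ι] in
lemma eq_add_sum_of_affine {κ : Type*} [Fintype κ] (e : OrthonormalBasis κ ℝ X)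
    {L : X → Matrix ι ι ℝ}
    (h : ∀ (x y : X) (r : ℝ), L (x + r • y) = L x + r • (L y - L 0)) (x y : X) :
    L y = L x + ∑ m, inner ℝ (e m) (y - x) • (L (e m) - L 0) := by
  let T : X →ₗ[ℝ] Matrix ι ι ℝ :=
    { toFun := fun v => L v - L 0
      map_add' := fun u v => by
        have := h u v 1
        rw [one_smul, one_smul] at this
        rw [this]
        abel
      map_smul' := fun r v => by
        have := h 0 v r
        rw [zero_add] at this
        rw [this, RingHom.id_apply]
        abel }
  have h1 : L y = L x + T (y - x) := by
    have := h x (y - x) 1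
    rw [one_smul, one_smul, add_sub_cancel] at this
    exact this
  have h2 : T (y - x) = ∑ m, inner ℝ (e m) (y - x) • T (e m) := by
    conv_lhs => rw [← e.sum_repr' (y - x)]
    rw [map_sum]
    exact Finset.sum_congr rfl fun m _ => map_smul _ _ _
  rw [h1, h2]
  rfl

/-- The chain rule subgradient of `x ↦ max 0 (lambdaMax (L x)) ^ p`, for a family `L` that is
affine in `x`: the adjoint of the linear part of `L`, in coordinates with respect to the
orthonormal basis `e`, applied to the subgradient `topProj (L x)`. -/
noncomputable def chainSubgradient {κ : Type*} [Fintype κ] (e : OrthonormalBasis κ ℝ X) (p : ℝ)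
    (L : X → Matrix ι ι ℝ) (x : X) : X :=
  ∑ m, (posPowSlope p (lambdaMax (L x)) *
    ∑ i, ∑ j, topProj (L x) i j * (L (e m) i j - L 0 i j)) • e m

lemma chainSubgradient_mem {κ : Type*} [Fintype κ] (e : OrthonormalBasis κ ℝ X) {p : ℝ}
    (hp : 1 ≤ p) {L : X → Matrix ι ι ℝ}
    (haff : ∀ (x y : X) (r : ℝ), L (x + r • y) = L x + r • (L y - L 0))
    (hsymm : ∀ x, (L x).IsSymm) (x : X) :
    chainSubgradient e p L x ∈ subdifferential (fun x => max 0 (lambdaMax (L x)) ^ p) x := by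
  intro y
  have hin : inner ℝ (chainSubgradient e p L x) (y - x)
      = posPowSlope p (lambdaMax (L x)) *
        (∑ i, ∑ j, topProj (L x) i j * L y i j - lambdaMax (L x)) := by
    have hL : ∀ i j, L y i j - L x i j
        = ∑ m, inner ℝ (e m) (y - x) * (L (e m) i j - L 0 i j) := fun i j => by
      have h := congrFun (congrFun (eq_add_sum_of_affine e haff x y) i) j
      rw [Matrix.add_apply, Matrix.sum_apply] at h
      rw [h]
      simp
    rw [chainSubgradient, sum_inner, ← sum_topProj_mul_self (hsymm x), ← Finset.sum_sub_distrib]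
    simp only [← Finset.sum_sub_distrib, ← mul_sub, hL, real_inner_smul_left, mul_assoc]
    rw [← Finset.mul_sum]
    congr 1
    simp only [Finset.sum_mul, Finset.mul_sum]
    rw [Finset.sum_comm]
    refine Finset.sum_congr rfl fun i _ => ?_
    rw [Finset.sum_comm]
    exact Finset.sum_congr rfl fun j _ => Finset.sum_congr rfl fun m _ => by ring
  rw [hin]
  refine le_trans ?_ (posPow_add_slope_mul_le hp (lambdaMax (L x)) (lambdaMax (L y)))
  gcongr
  · exact posPowSlope_nonneg hp _
  · exact sum_topProj_mul_le (hsymm x) (hsymm y)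

lemma norm_chainSubgradient_le {κ : Type*} [Fintype κ] (e : OrthonormalBasis κ ℝ X) {p : ℝ}
    (hp : 1 ≤ p) {L : X → Matrix ι ι ℝ}
    (haff : ∀ (x y : X) (r : ℝ), L (x + r • y) = L x + r • (L y - L 0))
    (hsymm : ∀ x, (L x).IsSymm) {K R : ℝ} (hK : 0 ≤ K) (hR : 0 ≤ R)
    (h0 : ∀ i j, |L 0 i j| ≤ K) (he : ∀ m i j, |L (e m) i j| ≤ K) {x : X} (hx : ‖x‖ ≤ R) :
    ‖chainSubgradient e p L x‖ ≤ ∑ _m : κ,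
      (p * (∑ _i : ι, ∑ _j : ι, (K + ∑ _m : κ, R * (K + K))) ^ (p - 1) *
        ∑ _i : ι, ∑ _j : ι, (K + K)) := by
  have hd : ∀ m i j, |L (e m) i j - L 0 i j| ≤ K + K := fun m i j =>
    (abs_sub _ _).trans (add_le_add (he m i j) (h0 i j))
  have hLx : ∀ i j, |L x i j| ≤ K + ∑ _m : κ, R * (K + K) := fun i j => by
    have h := congrFun (congrFun (eq_add_sum_of_affine e haff 0 x) i) j
    rw [Matrix.add_apply, Matrix.sum_apply, sub_zero] at h
    rw [h]
    refine (abs_add_le _ _).trans (add_le_add (h0 i j) ?_)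
    refine (Finset.abs_sum_le_sum_abs _ _).trans (Finset.sum_le_sum fun m _ => ?_)
    rw [Matrix.smul_apply, Matrix.sub_apply, smul_eq_mul, abs_mul]
    refine mul_le_mul ?_ (hd m i j) (abs_nonneg _) hR
    refine (abs_real_inner_le_norm _ _).trans ?_
    rwa [e.orthonormal.1 m, one_mul]
  have hlam : lambdaMax (L x) ≤ ∑ _i : ι, ∑ _j : ι, (K + ∑ _m : κ, R * (K + K)) := by
    rw [← sum_topProj_mul_self (hsymm x)]
    refine Finset.sum_le_sum fun i _ => Finset.sum_le_sum fun j _ => ?_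
    refine (le_abs_self _).trans ?_
    rw [abs_mul]
    refine (mul_le_of_le_one_left (abs_nonneg _) (abs_topProj_apply_le_one (hsymm x) i j)).trans
      (hLx i j)
  unfold chainSubgradient
  refine (norm_sum_le _ _).trans (Finset.sum_le_sum fun m _ => ?_)
  rw [norm_smul, e.orthonormal.1 m, mul_one, Real.norm_eq_abs, abs_mul,
    abs_of_nonneg (posPowSlope_nonneg hp _)]
  refine mul_le_mul (posPowSlope_le hp (by positivity) hlam) ?_ (abs_nonneg _) (by positivity)
  refine (Finset.abs_sum_le_sum_abs _ _).trans (Finset.sum_le_sum fun i _ => ?_)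
  refine (Finset.abs_sum_le_sum_abs _ _).trans (Finset.sum_le_sum fun j _ => ?_)
  rw [abs_mul]
  exact (mul_le_of_le_one_left (abs_nonneg _) (abs_topProj_apply_le_one (hsymm x) i j)).trans
    (hd m i j)

lemma measurable_chainSubgradient [MeasurableSpace X] [BorelSpace X]
    [SecondCountableTopology X] {κ : Type*} [Fintype κ]
    (e : OrthonormalBasis κ ℝ X) (p : ℝ) {L : ℝ → X → Matrix ι ι ℝ}
    (hsymm : ∀ t x, (L t x).IsSymm) (hmeas : ∀ x i j, Measurable fun t => L t x i j) (x : X) :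
    Measurable fun t => chainSubgradient e p (L t) x := by
  have htop : ∀ i j, Measurable fun t => topProj (L t x) i j := fun i j =>
    (measurable_topProj_apply i j).comp
      (measurable_pi_lambda _ fun a => measurable_pi_lambda _ fun b => hmeas x a b)
  have hlam : Measurable fun t => lambdaMax (L t x) := by
    simp only [← sum_topProj_mul_self (hsymm _ x)]
    exact Finset.measurable_sum _ fun i _ => Finset.measurable_sum _ fun j _ =>
      (htop i j).mul (hmeas x i j)
  unfold chainSubgradient
  refine Finset.measurable_sum _ fun m _ => Measurable.smul_const ?_ _
  refine ((measurable_posPowSlope p).comp hlam).mul ?_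
  exact Finset.measurable_sum _ fun i _ => Finset.measurable_sum _ fun j _ =>
    (htop i j).mul ((hmeas _ i j).sub (hmeas _ i j))

/-- A family of symmetric matrices that is affine in `x`, and measurable and bounded in `t`,
has a measurable and locally bounded selection of subgradients in `x` of
`max 0 (lambdaMax (L t x)) ^ p`. -/
theorem exists_measurable_subgradient [FiniteDimensional ℝ X] [MeasurableSpace X] [BorelSpace X]
    {a b p : ℝ} (hp : 1 ≤ p) {L : ℝ → X → Matrix ι ι ℝ}
    (haff : ∀ t ∈ Icc a b, ∀ (x y : X) (r : ℝ), L t (x + r • y) = L t x + r • (L t y - L t 0))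
    (hsymm : ∀ t ∈ Icc a b, ∀ x, (L t x).IsSymm)
    (hreg : ∀ x, FunnelData.MeasurableBounded a b fun t => L t x) :
    ∃ g : ℝ → X → X, (∀ x, Measurable fun t => g t x) ∧
      (∀ x, ∀ᵐ t ∂(volume.restrict (Icc a b)),
        g t x ∈ subdifferential (fun x => max 0 (lambdaMax (L t x)) ^ p) x) ∧
      (∀ R : ℝ, ∃ M : ℝ, ∀ x, ‖x‖ ≤ R → ∀ t ∈ Icc a b, ‖g t x‖ ≤ M) ∧
      (∀ x, IntegrableOn (fun t => g t x) (Icc a b)) := by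
  let e := stdOrthonormalBasis ℝ X
  -- The family is determined by its values at `0` and at the basis vectors. On a measurable set
  -- `S` of full measure these finitely many functions of `t` agree with measurable ones.
  let pt : Option (Fin (Module.finrank ℝ X)) → X := fun o => o.elim 0 fun m => e m
  have hae : ∀ᵐ t ∂(volume.restrict (Icc a b)), t ∈ Icc a b ∧ ∀ o i j,
      L t (pt o) i j = (hreg (pt o) i j).1.mk _ t := by
    refine (ae_restrict_mem measurableSet_Icc).and ?_
    simp only [ae_all_iff]
    exact fun o i j => (hreg (pt o) i j).1.ae_eq_mk
  obtain ⟨S, hSae, hSmeas, hS⟩ := hae.exists_measurable_mem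
  classical
  let L' : ℝ → X → Matrix ι ι ℝ := fun t x => if t ∈ S then L t x else 0
  have haff' : ∀ t (x y : X) (r : ℝ), L' t (x + r • y) = L' t x + r • (L' t y - L' t 0) := by
    intro t x y r
    by_cases ht : t ∈ S
    · simpa [L', ht] using haff t (hS t ht).1 x y r
    · simp [L', ht]
  have hsymm' : ∀ t x, (L' t x).IsSymm := fun t x => by
    by_cases ht : t ∈ S
    · simpa [L', ht] using hsymm t (hS t ht).1 x
    · simp [L', ht]
  have hmeas_pt : ∀ o i j, Measurable fun t => L' t (pt o) i j := fun o i j => by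
    have : (fun t => L' t (pt o) i j) = S.indicator ((hreg (pt o) i j).1.mk _) := by
      ext t
      by_cases ht : t ∈ S
      · simp only [L', if_pos ht, indicator_of_mem ht, (hS t ht).2 o i j]
      · simp [L', ht]
    rw [this]
    exact (hreg (pt o) i j).1.measurable_mk.indicator hSmeas
  have hmeas : ∀ x i j, Measurable fun t => L' t x i j := fun x i j => by
    have : (fun t => L' t x i j) = fun t => L' t (pt none) i j +
        ∑ m, inner ℝ (e m) (x - 0) * (L' t (pt (some m)) i j - L' t (pt none) i j) := by
      ext t
      have h := congrFun (congrFun (eq_add_sum_of_affine e (haff' t) 0 x) i) j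
      rwa [Matrix.add_apply, Matrix.sum_apply] at h
    rw [this]
    exact (hmeas_pt none i j).add (Finset.measurable_sum _ fun m _ =>
      ((hmeas_pt (some m) i j).sub (hmeas_pt none i j)).const_mul _)
  choose K hK using fun o => (hreg (pt o)).exists_bound
  obtain ⟨B, hB⟩ := Finite.exists_le K
  have hbound : ∀ t o i j, |L' t (pt o) i j| ≤ max B 0 := fun t o i j => by
    by_cases ht : t ∈ S
    · simp only [L', if_pos ht]
      exact ((hK o t (hS t ht).1 i j).trans (hB o)).trans (le_max_left _ _)
    · simp [L', ht]
  have hg_meas := measurable_chainSubgradient e p hsymm' hmeas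
  have hg_bound : ∀ R : ℝ, ∃ M : ℝ, ∀ x, ‖x‖ ≤ R → ∀ t, ‖chainSubgradient e p (L' t) x‖ ≤ M :=
    fun R => ⟨_, fun x hx t => norm_chainSubgradient_le e hp (haff' t) (hsymm' t)
      (le_max_right B 0) (abs_nonneg R) (hbound t none) (fun m => hbound t (some m))
      (hx.trans (le_abs_self R))⟩
  refine ⟨fun t x => chainSubgradient e p (L' t) x, hg_meas, fun x => ?_, fun R => ?_,
    fun x => ?_⟩
  · filter_upwards [hSae] with t ht
    have h := chainSubgradient_mem e hp (haff' t) (hsymm' t) x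
    have hL : L' t = L t := funext fun x => if_pos ht
    rwa [hL] at h ⊢
  · obtain ⟨M, hM⟩ := hg_bound R
    exact ⟨M, fun x hx t _ => hM x hx t⟩
  · obtain ⟨M, hM⟩ := hg_bound ‖x‖
    exact Measure.integrableOn_of_bounded measure_Icc_lt_top.ne
      (hg_meas x).aestronglyMeasurable (M := M) (ae_of_all _ fun t => hM x le_rfl t)

end Selection

namespace FunnelData

/-! ### Measurable bounded functions and matrices -/

/-- A real function that is Lebesgue measurable and bounded on `[a, b]`: the scalar version of
`MeasurableBounded`. -/
def BddMeas (a b : ℝ) (f : ℝ → ℝ) : Prop :=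
  AEMeasurable f (volume.restrict (Icc a b)) ∧ ∃ K, ∀ t ∈ Icc a b, |f t| ≤ K

section Closure

variable {a b : ℝ} {f g : ℝ → ℝ}

lemma BddMeas.congr (hf : BddMeas a b f) (h : ∀ t ∈ Icc a b, f t = g t) : BddMeas a b g := by
  obtain ⟨K, hK⟩ := hf.2
  exact ⟨hf.1.congr ((ae_restrict_mem measurableSet_Icc).mono h),
    K, fun t ht => h t ht ▸ hK t ht⟩

lemma BddMeas.const (r : ℝ) : BddMeas a b fun _ => r :=
  ⟨aemeasurable_const, |r|, fun _ _ => le_rfl⟩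

lemma BddMeas.add (hf : BddMeas a b f) (hg : BddMeas a b g) : BddMeas a b fun t => f t + g t := by
  obtain ⟨K, hK⟩ := hf.2
  obtain ⟨K', hK'⟩ := hg.2
  exact ⟨hf.1.add hg.1, K + K', fun t ht =>
    (abs_add_le _ _).trans (add_le_add (hK t ht) (hK' t ht))⟩

lemma BddMeas.mul (hf : BddMeas a b f) (hg : BddMeas a b g) : BddMeas a b fun t => f t * g t := by
  obtain ⟨K, hK⟩ := hf.2
  obtain ⟨K', hK'⟩ := hg.2
  refine ⟨hf.1.mul hg.1, K * K', fun t ht => ?_⟩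
  rw [abs_mul]
  exact mul_le_mul (hK t ht) (hK' t ht) (abs_nonneg _) ((abs_nonneg _).trans (hK t ht))

lemma BddMeas.neg (hf : BddMeas a b f) : BddMeas a b fun t => -f t := by
  obtain ⟨K, hK⟩ := hf.2
  exact ⟨hf.1.neg, K, fun t ht => by rw [abs_neg]; exact hK t ht⟩

lemma BddMeas.sub (hf : BddMeas a b f) (hg : BddMeas a b g) : BddMeas a b fun t => f t - g t := by
  simpa only [sub_eq_add_neg] using hf.add hg.neg

lemma BddMeas.sum {κ : Type*} (s : Finset κ) {F : κ → ℝ → ℝ}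
    (h : ∀ i ∈ s, BddMeas a b (F i)) : BddMeas a b fun t => ∑ i ∈ s, F i t := by
  classical
  induction s using Finset.induction_on with
  | empty => simpa using BddMeas.const 0
  | insert i s hi ih =>
    simp only [Finset.sum_insert hi]
    exact (h i (Finset.mem_insert_self _ _)).add
      (ih fun j hj => h j (Finset.mem_insert_of_mem hj))

lemma BddMeas.prod {κ : Type*} (s : Finset κ) {F : κ → ℝ → ℝ}
    (h : ∀ i ∈ s, BddMeas a b (F i)) : BddMeas a b fun t => ∏ i ∈ s, F i t := by
  classical
  induction s using Finset.induction_on with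
  | empty => simpa using BddMeas.const 1
  | insert i s hi ih =>
    simp only [Finset.prod_insert hi]
    exact (h i (Finset.mem_insert_self _ _)).mul
      (ih fun j hj => h j (Finset.mem_insert_of_mem hj))

lemma BddMeas.mono {a' b' : ℝ} (hf : BddMeas a b f) (h : Icc a' b' ⊆ Icc a b) :
    BddMeas a' b' f := by
  obtain ⟨K, hK⟩ := hf.2
  exact ⟨hf.1.mono_set h, K, fun t ht => hK t (h ht)⟩

lemma BddMeas.of_continuousOn (hf : ContinuousOn f (Icc a b)) : BddMeas a b f :=
  ⟨hf.aemeasurable measurableSet_Icc, isCompact_Icc.exists_bound_of_continuousOn hf⟩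

lemma BddMeas.integrableOn (hf : BddMeas a b f) : IntegrableOn f (Icc a b) := by
  obtain ⟨K, hK⟩ := hf.2
  exact ⟨hf.1.aestronglyMeasurable, HasFiniteIntegral.of_bounded
    (C := K) ((ae_restrict_mem measurableSet_Icc).mono hK)⟩

/-- A jointly continuous function along a measurable bounded curve. -/
lemma BddMeas.comp_of_continuousOn {E : Type*} [NormedAddCommGroup E] [ProperSpace E]
    [MeasurableSpace E] [BorelSpace E] {psi : ℝ → E}
    (hm : AEMeasurable psi (volume.restrict (Icc a b)))
    (hb : ∃ K, ∀ t ∈ Icc a b, ‖psi t‖ ≤ K) {Phi : ℝ × E → ℝ}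
    (hPhi : ContinuousOn Phi (Icc a b ×ˢ univ)) :
    BddMeas a b fun t => Phi (t, psi t) := by
  classical
  have : SecondCountableTopology E := secondCountable_of_proper
  constructor
  · have hS : MeasurableSet (Icc a b ×ˢ (univ : Set E)) := measurableSet_Icc.prod .univ
    have h1 : Measurable ((Icc a b ×ˢ (univ : Set E)).piecewise Phi 0) :=
      hPhi.measurable_piecewise continuousOn_const hS
    have h2 : AEMeasurable (fun t => (t, psi t)) (volume.restrict (Icc a b)) :=
      aemeasurable_id.prodMk hm
    refine (h1.comp_aemeasurable h2).congr ?_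
    filter_upwards [ae_restrict_mem measurableSet_Icc] with t ht
    exact piecewise_eq_of_mem _ _ _ ⟨ht, mem_univ _⟩
  · obtain ⟨K, hK⟩ := hb
    have hc := (isCompact_Icc (a := a) (b := b)).prod (isCompact_closedBall (0 : E) K)
    obtain ⟨B, hB⟩ := hc.exists_bound_of_continuousOn
      (hPhi.mono (prod_mono_right (subset_univ _)))
    exact ⟨B, fun t ht => hB (t, psi t) ⟨ht, mem_closedBall_zero_iff.2 (hK t ht)⟩⟩

variable {l m n o : Type*} {M M' : ℝ → Matrix m n ℝ}

lemma MeasurableBounded.const (M : Matrix m n ℝ) : MeasurableBounded a b fun _ => M :=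
  fun _ _ => BddMeas.const _

lemma MeasurableBounded.add (hM : MeasurableBounded a b M) (hM' : MeasurableBounded a b M') :
    MeasurableBounded a b fun t => M t + M' t := fun i j => BddMeas.add (hM i j) (hM' i j)

lemma MeasurableBounded.sub (hM : MeasurableBounded a b M) (hM' : MeasurableBounded a b M') :
    MeasurableBounded a b fun t => M t - M' t := fun i j => BddMeas.sub (hM i j) (hM' i j)

lemma MeasurableBounded.neg (hM : MeasurableBounded a b M) :
    MeasurableBounded a b fun t => -M t := fun i j => BddMeas.neg (hM i j)

lemma MeasurableBounded.smul (hf : BddMeas a b f) (hM : MeasurableBounded a b M) :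
    MeasurableBounded a b fun t => f t • M t := fun i j => BddMeas.mul hf (hM i j)

lemma MeasurableBounded.transpose (hM : MeasurableBounded a b M) :
    MeasurableBounded a b fun t => (M t)ᵀ := fun i j => hM j i

lemma MeasurableBounded.mul [Fintype n] {M'' : ℝ → Matrix n o ℝ} (hM : MeasurableBounded a b M)
    (hM' : MeasurableBounded a b M'') : MeasurableBounded a b fun t => M t * M'' t :=
  fun i j => BddMeas.sum Finset.univ (F := fun k t => M t i k * M'' t k j)
    fun k _ => BddMeas.mul (hM i k) (hM' k j)

lemma MeasurableBounded.fromRows {M'' : ℝ → Matrix l n ℝ} (hM : MeasurableBounded a b M)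
    (hM' : MeasurableBounded a b M'') :
    MeasurableBounded a b fun t => Matrix.fromRows (M t) (M'' t) := by
  rintro (i | i) j
  · exact hM i j
  · exact hM' i j

lemma MeasurableBounded.fromBlocks {M₁ : ℝ → Matrix l n ℝ} {M₂ : ℝ → Matrix l o ℝ}
    {M₃ : ℝ → Matrix m n ℝ} {M₄ : ℝ → Matrix m o ℝ} (h₁ : MeasurableBounded a b M₁)
    (h₂ : MeasurableBounded a b M₂) (h₃ : MeasurableBounded a b M₃)
    (h₄ : MeasurableBounded a b M₄) :
    MeasurableBounded a b fun t => Matrix.fromBlocks (M₁ t) (M₂ t) (M₃ t) (M₄ t) := by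
  rintro (i | i) (j | j)
  · exact h₁ i j
  · exact h₂ i j
  · exact h₃ i j
  · exact h₄ i j

lemma MeasurableBounded.mono {a' b' : ℝ} (hM : MeasurableBounded a b M)
    (h : Icc a' b' ⊆ Icc a b) : MeasurableBounded a' b' M := fun i j => BddMeas.mono (hM i j) h

lemma MeasurableBounded.of_continuousOn (hM : ContinuousOn M (Icc a b)) :
    MeasurableBounded a b M := fun i j =>
  BddMeas.of_continuousOn (((continuous_id.matrix_elem i j).comp_continuousOn hM :))

lemma MeasurableBounded.det [Fintype n] [DecidableEq n] {M : ℝ → Matrix n n ℝ}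
    (hM : MeasurableBounded a b M) : BddMeas a b fun t => (M t).det := by
  simp only [Matrix.det_apply']
  exact BddMeas.sum _ fun σ _ => (BddMeas.const _).mul (BddMeas.prod _ fun i _ => hM _ _)

/-- Measurability of the inverse comes from Cramer's rule; boundedness has to be assumed. -/
lemma MeasurableBounded.inv [Fintype n] [DecidableEq n] {M : ℝ → Matrix n n ℝ}
    (hM : MeasurableBounded a b M) (hb : ∃ K, ∀ t ∈ Icc a b, ∀ i j, |(M t)⁻¹ i j| ≤ K) :
    MeasurableBounded a b fun t => (M t)⁻¹ := by
  intro i j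
  obtain ⟨K, hK⟩ := hb
  refine ⟨?_, K, fun t ht => hK t ht i j⟩
  have hadj : BddMeas a b fun t => (M t).adjugate i j := by
    simp only [Matrix.adjugate_apply]
    refine MeasurableBounded.det fun r s => ?_
    simp only [Matrix.updateRow_apply]
    split_ifs
    · exact BddMeas.const _
    · exact hM r s
  simp only [Matrix.inv_def, Matrix.smul_apply, smul_eq_mul, Ring.inverse_eq_inv']
  exact hM.det.1.inv.mul hadj.1

end Closure

/-! ### Regularity of the data along the nominal trajectory -/

section Data

variable {P : FunnelData} (hP : P.Regular)

include hP

/-- A function that is jointly continuous in time, state and input, along the nominal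
trajectory. -/
lemma Regular.bddMeas_nominal
    {Phi : ℝ × EuclideanSpace ℝ (Fin P.nx) × EuclideanSpace ℝ (Fin P.nu) → ℝ}
    (hPhi : ContinuousOn Phi (Icc P.t0 P.tf ×ˢ univ)) :
    BddMeas P.t0 P.tf fun t => Phi (t, P.xbar t, P.ubar t) := by
  refine BddMeas.comp_of_continuousOn (psi := fun t => (P.xbar t, P.ubar t))
    ((hP.xbar_cont.aemeasurable measurableSet_Icc).prodMk hP.ubar_meas) ?_ hPhi
  obtain ⟨K, hK⟩ := isCompact_Icc.exists_bound_of_continuousOn hP.xbar_cont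
  obtain ⟨K', hK'⟩ := hP.ubar_bdd
  exact ⟨max K K', fun t ht => max_le_max (hK t ht) (hK' t ht)⟩

lemma Regular.phiJac_reg : MeasurableBounded P.t0 P.tf P.phiJac := by
  intro i j
  let q : EuclideanSpace ℝ (Fin P.nx) × EuclideanSpace ℝ (Fin P.nu) →
      EuclideanSpace ℝ (Fin P.nqo) := fun v => WithLp.toLp 2 (P.Co *ᵥ v.1.ofLp + P.Do *ᵥ v.2.ofLp)
  have hq : Continuous q := by
    refine (PiLp.continuous_toLp 2 _).comp ?_
    have h1 : Continuous fun v : EuclideanSpace ℝ (Fin P.nx) × EuclideanSpace ℝ (Fin P.nu) =>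
        v.1.ofLp := (PiLp.continuous_ofLp 2 _).comp continuous_fst
    have h2 : Continuous fun v : EuclideanSpace ℝ (Fin P.nx) × EuclideanSpace ℝ (Fin P.nu) =>
        v.2.ofLp := (PiLp.continuous_ofLp 2 _).comp continuous_snd
    exact (continuous_const.matrix_mulVec h1).add (continuous_const.matrix_mulVec h2)
  have hc : ContinuousOn (fun s : ℝ × EuclideanSpace ℝ (Fin P.nx) × EuclideanSpace ℝ (Fin P.nu) =>
      (fderiv ℝ (P.phi s.1) (q s.2) (EuclideanSpace.single j 1)) i) (Icc P.t0 P.tf ×ˢ univ) := by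
    have h1 := hP.phi_jac_cont.comp
      (f := fun s : ℝ × EuclideanSpace ℝ (Fin P.nx) × EuclideanSpace ℝ (Fin P.nu) => (s.1, q s.2))
      (s := Icc P.t0 P.tf ×ˢ univ) (by fun_prop) (fun s hs => ⟨hs.1, mem_univ _⟩)
    have h2 := h1.clm_apply (continuousOn_const (c := EuclideanSpace.single j (1 : ℝ)))
    exact (EuclideanSpace.proj i : _ →L[ℝ] ℝ).continuous.comp_continuousOn h2
  exact hP.bddMeas_nominal hc

lemma Regular.A_reg : MeasurableBounded P.t0 P.tf P.A :=
  (MeasurableBounded.of_continuousOn hP.Ao_cont).add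
    (((MeasurableBounded.const P.E).mul hP.phiJac_reg).mul (.const P.Co))

lemma Regular.B_reg : MeasurableBounded P.t0 P.tf P.B :=
  (MeasurableBounded.of_continuousOn hP.Bo_cont).add
    (((MeasurableBounded.const P.E).mul hP.phiJac_reg).mul (.const P.Do))

lemma Regular.F_reg : MeasurableBounded P.t0 P.tf P.F :=
  (MeasurableBounded.of_continuousOn hP.Fo_cont).add
    (((MeasurableBounded.const P.E).mul hP.phiJac_reg).mul (.const P.Go))

lemma Regular.T22_inv_reg : MeasurableBounded P.t0 P.tf fun t => (P.T22 t)⁻¹ :=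
  hP.T22_reg.inv hP.T22_inv_bdd

lemma Regular.Lam_reg : MeasurableBounded P.t0 P.tf P.Lam := hP.T12_reg.mul hP.T22_inv_reg

lemma Regular.Sig_reg : MeasurableBounded P.t0 P.tf P.Sig :=
  hP.T11_reg.sub ((hP.T12_reg.mul hP.T22_inv_reg).mul hP.T21_reg)

omit hP in
lemma continuous_gradient_of_contDiff {n : ℕ} {f : EuclideanSpace ℝ (Fin n) → ℝ}
    (hf : ContDiff ℝ 1 f) : Continuous (gradient f) :=
  (InnerProductSpace.toDual ℝ (EuclideanSpace ℝ (Fin n))).symm.continuous.comp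
    (hf.continuous_fderiv one_ne_zero)

lemma Regular.ah_reg (i : Fin P.mx) (j : Fin P.nx) : BddMeas P.t0 P.tf fun t => P.ah i t j := by
  refine hP.bddMeas_nominal (Phi := fun s => gradient (P.h i) s.2.1 j) (Continuous.continuousOn ?_)
  have := continuous_gradient_of_contDiff (hP.h_smooth i)
  exact (EuclideanSpace.proj j : _ →L[ℝ] ℝ).continuous.comp (this.comp (by fun_prop))

lemma Regular.ag_reg (i : Fin P.mu) (j : Fin P.nu) : BddMeas P.t0 P.tf fun t => P.ag i t j := by
  refine hP.bddMeas_nominal (Phi := fun s => gradient (P.g i) s.2.2 j) (Continuous.continuousOn ?_)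
  have := continuous_gradient_of_contDiff (hP.g_smooth i)
  exact (EuclideanSpace.proj j : _ →L[ℝ] ℝ).continuous.comp (this.comp (by fun_prop))

/-- The corner entry of the state constraint is `h_i(x̄)²`. -/
lemma Regular.state_corner_reg (i : Fin P.mx) :
    BddMeas P.t0 P.tf fun t => (P.bh i t - inner ℝ (P.ah i t) (P.xbar t)) ^ 2 := by
  have h := hP.bddMeas_nominal (Phi := fun s => P.h i s.2.1 ^ 2)
    ((((hP.h_smooth i).continuous.comp (by fun_prop)).pow 2).continuousOn)
  refine h.congr fun t _ => ?_
  simp only [bh]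
  ring

/-- The corner entry of the input constraint is `g_j(ū)²`. -/
lemma Regular.input_corner_reg (i : Fin P.mu) :
    BddMeas P.t0 P.tf fun t => (P.bg i t - inner ℝ (P.ag i t) (P.ubar t)) ^ 2 := by
  have h := hP.bddMeas_nominal (Phi := fun s => P.g i s.2.2 ^ 2)
    ((((hP.g_smooth i).continuous.comp (by fun_prop)).pow 2).continuousOn)
  refine h.congr fun t _ => ?_
  simp only [bg]
  ring

end Data

end FunnelData

/-! ### The funnel state depends linearly on the decision variable -/

/-- Grönwall's inequality in integral form, with zero initial value. -/
lemma eq_zero_of_le_mul_integral {a b K : ℝ} {w : ℝ → ℝ} (hw : ContinuousOn w (Icc a b))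
    (h0 : ∀ t ∈ Icc a b, 0 ≤ w t) (h : ∀ t ∈ Icc a b, w t ≤ K * ∫ r in a..t, w r) :
    ∀ t ∈ Icc a b, w t = 0 := by
  intro t ht
  have hab : a ≤ b := ht.1.trans ht.2
  have hcont : Continuous (IccExtend hab ((Icc a b).domRestrict w)) := hw.domRestrict.Icc_extend'
  set v := IccExtend hab ((Icc a b).domRestrict w) with hv
  have hvw : ∀ s ∈ Icc a b, v s = w s := fun s hs => by rw [hv, IccExtend_of_mem _ _ hs]; rfl
  have hint : ∀ s ∈ Icc a b, ∫ r in a..s, v r = ∫ r in a..s, w r := fun s hs =>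
    intervalIntegral.integral_congr fun r hr => by
      rw [uIcc_of_le hs.1] at hr
      exact hvw r ⟨hr.1, hr.2.trans hs.2⟩
  have hder : ∀ s, HasDerivAt (fun s => ∫ r in a..s, v r) (v s) s := fun s =>
    intervalIntegral.integral_hasDerivAt_right (hcont.intervalIntegrable _ _)
      (hcont.stronglyMeasurableAtFilter _ _) hcont.continuousAt
  have hnonneg : ∀ s ∈ Icc a b, 0 ≤ ∫ r in a..s, w r := fun s hs =>
    intervalIntegral.integral_nonneg hs.1 fun r hr => h0 r ⟨hr.1, hr.2.trans hs.2⟩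
  have hg := norm_le_gronwallBound_of_norm_deriv_right_le (f := fun s => ∫ r in a..s, v r)
    (f' := v) (δ := 0) (K := K) (ε := 0) (a := a) (b := b)
    (fun s _ => (hder s).continuousAt.continuousWithinAt)
    (fun s _ => (hder s).hasDerivWithinAt) (by simp) (fun s hs => by
      have hs' := Ico_subset_Icc_self hs
      rw [hvw s hs', hint s hs', Real.norm_of_nonneg (h0 s hs'),
        Real.norm_of_nonneg (hnonneg s hs'), add_zero]
      exact h s hs') t ht
  rw [gronwallBound_ε0_δ0, norm_le_zero_iff, hint t ht] at hg
  have := h t ht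
  rw [hg, mul_zero] at this
  exact le_antisymm this (h0 t ht)

namespace FunnelData

variable {P : FunnelData}

lemma channelArg_add_smul (Q Q' : Matrix (Fin P.nx) (Fin P.nx) ℝ) (z z' : P.InputVec) (r : ℝ) :
    P.C * (Q + r • Q') + P.D * Y (z + r • z')
      = (P.C * Q + P.D * Y z) + r • (P.C * Q' + P.D * Y z') := by
  have hY : Y (z + r • z') = Y z + r • Y z' := rfl
  rw [hY]
  simp only [Matrix.mul_add, Matrix.mul_smul, smul_add]
  abel

lemma H11_add_smul (t : ℝ) (Q Q' : Matrix (Fin P.nx) (Fin P.nx) ℝ) (z z' : P.InputVec) (r : ℝ) :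
    P.H11 t (Q + r • Q') (z + r • z') = P.H11 t Q z + r • P.H11 t Q' z' := by
  have hY : Y (z + r • z') = Y z + r • Y z' := rfl
  unfold H11
  rw [channelArg_add_smul, hY]
  simp only [Matrix.mul_add, Matrix.mul_smul, smul_add, smul_sub]
  rw [smul_comm (P.alpha / 2) r Q']
  abel

lemma dynRHS_add_smul (ty : DynamicsType) (t : ℝ) (Q Q' : Matrix (Fin P.nx) (Fin P.nx) ℝ)
    (z z' : P.InputVec) (r : ℝ) :
    P.dynRHS ty t (Q + r • Q') (z + r • z') = P.dynRHS ty t Q z + r • P.dynRHS ty t Q' z' := by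
  have hZ : Z (z + r • z') = Z z + r • Z z' := rfl
  cases ty
  · simp only [dynRHS, H11_add_smul, hZ, Matrix.transpose_add, Matrix.transpose_smul, smul_add]
    abel
  · exact hZ

lemma foh_add_smul (a b t r : ℝ) (c c' : EuclideanSpace ℝ P.ChiIdx) :
    foh a b (zetaM (c + r • c')) (zetaP (c + r • c')) t
      = foh a b (zetaM c) (zetaP c) t + r • foh a b (zetaM c') (zetaP c') t := by
  ext i
  simp only [foh, zetaM, zetaP, Pi.add_apply, Pi.smul_apply, PiLp.add_apply, PiLp.smul_apply,
    smul_eq_mul]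
  ring

lemma foh_reg (a b : ℝ) (z z' : P.InputVec) (i : P.InputIdx) :
    BddMeas a b fun t => foh a b z z' t i := by
  refine BddMeas.of_continuousOn (Continuous.continuousOn ?_)
  simp only [foh, Pi.add_apply, Pi.smul_apply, smul_eq_mul, div_eq_mul_inv]
  fun_prop

section Regularity

variable (hP : P.Regular) {a b : ℝ} (hab : Icc a b ⊆ Icc P.t0 P.tf)
  {Q : ℝ → Matrix (Fin P.nx) (Fin P.nx) ℝ} {z : ℝ → P.InputVec}

include hP hab

omit hP hab in
lemma channelArg_reg (hQ : MeasurableBounded a b Q) (hz : ∀ i, BddMeas a b fun t => z t i) :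
    MeasurableBounded a b fun t => P.C * Q t + P.D * Y (z t) :=
  ((MeasurableBounded.const P.C).mul hQ).add
    ((MeasurableBounded.const P.D).mul (M'' := fun t => Y (z t)) fun _ _ => hz _)

lemma Regular.H11_reg (hQ : MeasurableBounded a b Q) (hz : ∀ i, BddMeas a b fun t => z t i) :
    MeasurableBounded a b fun t => P.H11 t (Q t) (z t) :=
  ((((hP.A_reg.mono hab).mul hQ).add
    ((hP.B_reg.mono hab).mul (M'' := fun t => Y (z t)) fun _ _ => hz _)).sub
    ((((MeasurableBounded.const P.E).mul (hP.T22_inv_reg.mono hab)).mul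
      (hP.T21_reg.mono hab)).mul (channelArg_reg hQ hz))).add (.smul (.const _) hQ)

lemma Regular.dynRHS_reg (ty : DynamicsType) (hQ : MeasurableBounded a b Q)
    (hz : ∀ i, BddMeas a b fun t => z t i) :
    MeasurableBounded a b fun t => P.dynRHS ty t (Q t) (z t) := by
  have hZ : MeasurableBounded a b fun t => Z (z t) := fun _ _ => hz _
  cases ty
  · exact ((hP.H11_reg hab hQ hz).add (hP.H11_reg hab hQ hz).transpose).add hZ
  · exact hZ

/-- The homogeneous right-hand side is Lipschitz in `Q`, uniformly in time. -/
lemma Regular.exists_dynRHS_bound (ty : DynamicsType) :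
    ∃ K, ∀ t ∈ Icc a b, ∀ (W : Matrix (Fin P.nx) (Fin P.nx) ℝ) (i j : Fin P.nx),
      |P.dynRHS ty t W 0 i j| ≤ K * ∑ k, ∑ l, |W k l| := by
  have hreg : ∀ q : Fin P.nx × Fin P.nx,
      MeasurableBounded a b fun t => P.dynRHS ty t (Matrix.single q.1 q.2 1) 0 := fun q =>
    hP.dynRHS_reg hab ty (.const _) (z := fun _ => 0) fun i => BddMeas.const 0
  choose B hB using fun q => (hreg q).exists_bound
  obtain ⟨K, hK⟩ := Finite.exists_le B
  refine ⟨K, fun t ht W i j => ?_⟩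
  let T : Matrix (Fin P.nx) (Fin P.nx) ℝ →ₗ[ℝ] Matrix (Fin P.nx) (Fin P.nx) ℝ :=
    { toFun := fun W => P.dynRHS ty t W 0
      map_add' := fun V W => by simpa using dynRHS_add_smul ty t V W 0 0 1
      map_smul' := fun r W => by
        have h0 : P.dynRHS ty t 0 0 = 0 := by simpa using dynRHS_add_smul ty t 0 0 0 0 1
        simpa [h0] using dynRHS_add_smul ty t 0 W 0 0 r }
  have hT : P.dynRHS ty t W 0 = ∑ k, ∑ l, W k l • T (Matrix.single k l 1) := by
    change T W = _
    conv_lhs => rw [Matrix.matrix_eq_sum_single W]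
    simp only [map_sum]
    refine Finset.sum_congr rfl fun k _ => Finset.sum_congr rfl fun l _ => ?_
    rw [← map_smul, Matrix.smul_single, smul_eq_mul, mul_one]
  rw [hT]
  simp only [Matrix.sum_apply, Matrix.smul_apply, smul_eq_mul, Finset.mul_sum]
  refine (Finset.abs_sum_le_sum_abs _ _).trans (Finset.sum_le_sum fun k _ => ?_)
  refine (Finset.abs_sum_le_sum_abs _ _).trans (Finset.sum_le_sum fun l _ => ?_)
  rw [abs_mul, mul_comm]
  exact mul_le_mul_of_nonneg_right ((hB (k, l) t ht i j).trans (hK (k, l))) (abs_nonneg _)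

lemma Regular.funnelState_add_smul {ty : DynamicsType} {c c' : EuclideanSpace ℝ P.ChiIdx}
    {r : ℝ} {Q₁ Q₂ Q₃ : ℝ → Matrix (Fin P.nx) (Fin P.nx) ℝ} (h₁ : IsFunnelState ty a b c Q₁)
    (h₂ : IsFunnelState ty a b c' Q₂) (h₃ : IsFunnelState ty a b (c + r • c') Q₃) :
    ∀ t ∈ Icc a b, Q₃ t = Q₁ t + r • Q₂ t := by
  obtain ⟨K, hK⟩ := hP.exists_dynRHS_bound hab ty
  have hint : ∀ {d : EuclideanSpace ℝ P.ChiIdx} {V : ℝ → Matrix (Fin P.nx) (Fin P.nx) ℝ},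
      IsFunnelState ty a b d V → ∀ i j, ∀ t ∈ Icc a b, IntervalIntegrable
        (fun s => P.dynRHS ty s (V s) (foh a b (zetaM d) (zetaP d) s) i j) volume a t := by
    intro d V hV i j t ht
    have h := hP.dynRHS_reg hab ty (.of_continuousOn hV.1)
      (fun i => foh_reg a b (zetaM d) (zetaP d) i) i j
    rw [intervalIntegrable_iff_integrableOn_Icc_of_le ht.1]
    exact (BddMeas.integrableOn h).mono_set (Icc_subset_Icc_right ht.2)
  -- The defect `W` solves the homogeneous equation with zero initial value.
  let W : ℝ → Matrix (Fin P.nx) (Fin P.nx) ℝ := fun t => Q₃ t - Q₁ t - r • Q₂ t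
  have hWcont : ContinuousOn W (Icc a b) := (h₃.1.sub h₁.1).sub (h₂.1.const_smul r)
  have hWeq : ∀ t ∈ Icc a b, ∀ i j, W t i j = ∫ s in a..t, P.dynRHS ty s (W s) 0 i j := by
    intro t ht i j
    have hrhs : ∀ s, P.dynRHS ty s (W s) 0 i j
        = P.dynRHS ty s (Q₃ s)
            (foh a b (zetaM (c + r • c')) (zetaP (c + r • c')) s) i j
          - P.dynRHS ty s (Q₁ s) (foh a b (zetaM c) (zetaP c) s) i j
          - r * P.dynRHS ty s (Q₂ s) (foh a b (zetaM c') (zetaP c') s) i j := by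
      intro s
      have e1 := dynRHS_add_smul ty s (Q₁ s) (Q₂ s) (foh a b (zetaM c) (zetaP c) s)
        (foh a b (zetaM c') (zetaP c') s) r
      have e2 := dynRHS_add_smul ty s (Q₁ s + r • Q₂ s) (W s)
        (foh a b (zetaM c) (zetaP c) s + r • foh a b (zetaM c') (zetaP c') s) 0 1
      have e3 : Q₁ s + r • Q₂ s + (1 : ℝ) • W s = Q₃ s := by
        simp only [W, one_smul]
        abel
      rw [e3, e1, smul_zero, add_zero, one_smul, ← foh_add_smul] at e2
      rw [e2]
      simp only [Matrix.add_apply, Matrix.smul_apply, smul_eq_mul]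
      ring
    simp only [hrhs]
    rw [intervalIntegral.integral_sub ((hint h₃ i j t ht).sub (hint h₁ i j t ht))
        ((hint h₂ i j t ht).const_mul r),
      intervalIntegral.integral_sub (hint h₃ i j t ht) (hint h₁ i j t ht),
      intervalIntegral.integral_const_mul]
    have hq : Qnode (c + r • c') i j = Qnode c i j + r * Qnode c' i j := rfl
    simp only [W, Matrix.sub_apply, Matrix.smul_apply, smul_eq_mul, h₃.2 t ht i j, h₁.2 t ht i j,
      h₂.2 t ht i j, hq]
    ring
  have hwcont : ContinuousOn (fun t => ∑ i, ∑ j, |W t i j|) (Icc a b) :=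
    continuousOn_finsetSum _ fun i _ => continuousOn_finsetSum _ fun j _ =>
      ((continuous_id.matrix_elem i j).comp_continuousOn hWcont).abs
  have hzero := eq_zero_of_le_mul_integral (K := ∑ _i : Fin P.nx, ∑ _j : Fin P.nx, K) hwcont
    (fun t _ => Finset.sum_nonneg fun i _ => Finset.sum_nonneg fun j _ => abs_nonneg _)
    (fun t ht => by
      rw [Finset.sum_mul]
      refine Finset.sum_le_sum fun i _ => ?_
      rw [Finset.sum_mul]
      refine Finset.sum_le_sum fun j _ => ?_
      rw [hWeq t ht i j, ← intervalIntegral.integral_const_mul]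
      refine intervalIntegral.norm_integral_le_of_norm_le (f := fun s => P.dynRHS ty s (W s) 0 i j)
        ht.1 (ae_of_all _ fun s hs => hK s ⟨hs.1.le, hs.2.trans ht.2⟩ (W s) i j) ?_
      rw [intervalIntegrable_iff_integrableOn_Icc_of_le ht.1]
      exact ((hwcont.const_smul K).mono (Icc_subset_Icc_right ht.2)).integrableOn_Icc)
  intro t ht
  have hW : W t = 0 := by
    ext i j
    have h1 := (Finset.sum_eq_zero_iff_of_nonneg
      (fun i _ => Finset.sum_nonneg fun j _ => abs_nonneg _)).1 (hzero t ht) i (Finset.mem_univ _)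
    have h2 := (Finset.sum_eq_zero_iff_of_nonneg (fun j _ => abs_nonneg _)).1 h1 j
      (Finset.mem_univ _)
    exact abs_eq_zero.1 h2
  have : Q₃ t = Q₁ t + r • Q₂ t + W t := by
    simp only [W]
    abel
  rw [this, hW, add_zero]

end Regularity

lemma foh_symm (a b t : ℝ) {z z' : P.InputVec} (hz : SymmInput z) (hz' : SymmInput z') :
    SymmInput (foh a b z z' t) := by
  have h1 := (hz.1.smul ((b - t) / (b - a))).add (hz'.1.smul ((t - a) / (b - a)))
  have h2 := (hz.2.1.smul ((b - t) / (b - a))).add (hz'.2.1.smul ((t - a) / (b - a)))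
  have h3 := (hz.2.2.smul ((b - t) / (b - a))).add (hz'.2.2.smul ((t - a) / (b - a)))
  exact ⟨h1, h2, h3⟩

/-- The right-hand side of the dynamics is symmetric whatever `Q` is, and so is the state. -/
lemma IsFunnelState.isSymm {ty : DynamicsType} {a b : ℝ} {c : EuclideanSpace ℝ P.ChiIdx}
    (hc : c ∈ P.decisionSpace) {Q : ℝ → Matrix (Fin P.nx) (Fin P.nx) ℝ}
    (hQ : IsFunnelState ty a b c Q) {t : ℝ} (ht : t ∈ Icc a b) : (Q t).IsSymm := by
  have hrhs : ∀ s, (P.dynRHS ty s (Q s) (foh a b (zetaM c) (zetaP c) s)).IsSymm := fun s => by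
    have hZ := (foh_symm a b s hc.2.1 hc.2.2).1
    cases ty
    · exact (Matrix.isSymm_add_transpose_self _).add hZ
    · exact hZ
  ext i j
  rw [Matrix.transpose_apply, hQ.2 t ht, hQ.2 t ht, hc.1.apply]
  congr 1
  exact intervalIntegral.integral_congr fun s _ => (hrhs s).apply i j

/-! ### The constraint matrices are affine, symmetric, measurable and bounded -/

section Affine

variable (t r : ℝ) (Q Q' : Matrix (Fin P.nx) (Fin P.nx) ℝ) (z z' : P.InputVec)

lemma H11_zero : P.H11 t 0 0 = 0 := by simpa using H11_add_smul t 0 0 0 0 1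

lemma channelArg_zero : P.C * (0 : Matrix (Fin P.nx) (Fin P.nx) ℝ) + P.D * Y (0 : P.InputVec)
    = 0 := by
  have hY : Y (0 : P.InputVec) = 0 := rfl
  rw [hY, Matrix.mul_zero, Matrix.mul_zero, add_zero]

lemma H12_affine : P.H12 t (Q + r • Q') (z + r • z')
    = P.H12 t Q z + r • (P.H12 t Q' z' - P.H12 t 0 0) := by
  have hN : N2 (z + r • z') = N2 z + r • N2 z' := rfl
  have hN0 : N2 (0 : P.InputVec) = 0 := rfl
  unfold H12
  rw [channelArg_add_smul, channelArg_zero, hN, hN0]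
  ext (i | i | i) j <;>
    simp [Matrix.add_mul, Matrix.mul_add]
  ring

lemma H22_affine : P.H22 t (z + r • z') = P.H22 t z + r • (P.H22 t z' - P.H22 t 0) := by
  have hN2 : N2 (z + r • z') = N2 z + r • N2 z' := rfl
  have hN20 : N2 (0 : P.InputVec) = 0 := rfl
  have hN1 : N1 (z + r • z') = N1 z + r • N1 z' := rfl
  have hN10 : N1 (0 : P.InputVec) = 0 := rfl
  have hl : lamW (z + r • z') = lamW z + r * lamW z' := rfl
  have hl0 : lamW (0 : P.InputVec) = 0 := rfl
  unfold H22
  rw [hN2, hN20, hN1, hN10, hl, hl0]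
  ext (i | i | i) (j | j | j) <;>
    simp [Matrix.mul_add] <;> ring

lemma invBlock_affine (ty : DynamicsType) : P.invBlock ty t (Q + r • Q') (z + r • z')
    = P.invBlock ty t Q z + r • (P.invBlock ty t Q' z' - P.invBlock ty t 0 0) := by
  have hZ : Z (z + r • z') = Z z + r • Z z' := rfl
  have hZ0 : Z (0 : P.InputVec) = 0 := rfl
  cases ty
  · simp only [invBlock, hZ, hZ0, neg_zero, sub_zero, neg_add, smul_neg]
  · simp only [invBlock, hZ, hZ0, H11_add_smul, H11_zero, Matrix.transpose_add,
      Matrix.transpose_smul, Matrix.transpose_zero, add_zero, sub_zero, smul_sub, smul_add]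
    abel

lemma invLMI_affine (ty : DynamicsType) : P.invLMI ty t (Q + r • Q') (z + r • z')
    = P.invLMI ty t Q z + r • (P.invLMI ty t Q' z' - P.invLMI ty t 0 0) := by
  unfold invLMI
  rw [H12_affine, H22_affine, invBlock_affine]
  ext (i | i) (j | j) <;> simp

lemma stateLMI_affine (i : Fin P.mx) : P.stateLMI i t (Q + r • Q')
    = P.stateLMI i t Q + r • (P.stateLMI i t Q' - P.stateLMI i t 0) := by
  unfold stateLMI
  ext (i | i) (j | j) <;>
    simp [Matrix.vecMul_add, Matrix.add_mulVec, Matrix.vecMul_smul, Matrix.smul_mulVec] <;> ring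

lemma inputLMI_affine (j : Fin P.mu) : P.inputLMI j t (Q + r • Q') (z + r • z')
    = P.inputLMI j t Q z + r • (P.inputLMI j t Q' z' - P.inputLMI j t 0 0) := by
  have hY : Y (z + r • z') = Y z + r • Y z' := rfl
  have hY0 : Y (0 : P.InputVec) = 0 := rfl
  unfold inputLMI
  rw [hY, hY0]
  ext (i | i) (j | j) <;>
    simp [Matrix.vecMul_add, Matrix.add_mulVec, Matrix.vecMul_smul, Matrix.smul_mulVec] <;> ring

lemma smoothLMI_affine (i : Fin P.nc) : P.smoothLMI i (Q + r • Q') (z + r • z')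
    = P.smoothLMI i Q z + r • (P.smoothLMI i Q' z' - P.smoothLMI i 0 0) := by
  have hs : sVar (z + r • z') i = sVar z i + r * sVar z' i := rfl
  have hs0 : sVar (0 : P.InputVec) i = 0 := rfl
  unfold smoothLMI channel
  rw [channelArg_add_smul, channelArg_zero, hs, hs0]
  ext (i | i) (j | j) <;> simp <;> ring

end Affine

section Symmetric

variable (t : ℝ) {Q : Matrix (Fin P.nx) (Fin P.nx) ℝ} {z : P.InputVec}

lemma H22_isSymm (hz : SymmInput z) : (P.H22 t z).IsSymm := by
  refine Matrix.IsSymm.fromBlocks hz.2.2.neg (Matrix.transpose_transpose _) ?_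
  exact Matrix.IsSymm.fromBlocks ((Matrix.isSymm_one.smul _).neg) (Matrix.transpose_transpose _)
    hz.2.1.neg

lemma invLMI_isSymm (ty : DynamicsType) (hz : SymmInput z) : (P.invLMI ty t Q z).IsSymm := by
  refine Matrix.IsSymm.fromBlocks ?_ (Matrix.transpose_transpose _) (H22_isSymm t hz)
  cases ty
  · exact hz.1.neg
  · exact (Matrix.isSymm_add_transpose_self _).sub hz.1

lemma stateLMI_isSymm (i : Fin P.mx) (hQ : Q.IsSymm) : (P.stateLMI i t Q).IsSymm := by
  refine (Matrix.IsSymm.fromBlocks ?_ ?_ (hQ.smul _)).neg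
  · ext; rfl
  · rw [Matrix.transpose_replicateRow, ← Matrix.mulVec_transpose, hQ.eq]

lemma inputLMI_isSymm (j : Fin P.mu) (hQ : Q.IsSymm) : (P.inputLMI j t Q z).IsSymm := by
  refine (Matrix.IsSymm.fromBlocks ?_ ?_ (hQ.smul _)).neg
  · ext; rfl
  · rw [Matrix.transpose_replicateRow, ← Matrix.mulVec_transpose]

lemma smoothLMI_isSymm (i : Fin P.nc) (hQ : Q.IsSymm) : (P.smoothLMI i Q z).IsSymm :=
  (Matrix.IsSymm.fromBlocks (Matrix.isSymm_one.smul _) rfl hQ).neg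

end Symmetric

section Regularity

variable (hP : P.Regular) {a b : ℝ} (hab : Icc a b ⊆ Icc P.t0 P.tf)
  {Q : ℝ → Matrix (Fin P.nx) (Fin P.nx) ℝ} {z : ℝ → P.InputVec}

include hP hab

lemma Regular.H12_reg (hQ : MeasurableBounded a b Q) (hz : ∀ i, BddMeas a b fun t => z t i) :
    MeasurableBounded a b fun t => P.H12 t (Q t) (z t) := by
  have hN : MeasurableBounded a b fun t => N2 (z t) := fun _ _ => hz _
  have hT := (hP.T22_inv_reg.mono hab).transpose
  have hE := MeasurableBounded.const (a := a) (b := b) P.Eᵀ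
  exact ((hN.mul hT).mul hE).fromRows
    (((hP.F_reg.mono hab).transpose.sub
      ((((MeasurableBounded.const P.Gᵀ).mul (hP.T21_reg.mono hab).transpose).mul hT).mul
        hE)).fromRows
      ((hP.Sig_reg.mono hab).mul (channelArg_reg hQ hz)))

lemma Regular.H22_reg (hz : ∀ i, BddMeas a b fun t => z t i) :
    MeasurableBounded a b fun t => P.H22 t (z t) := by
  have hN2 : MeasurableBounded a b fun t => N2 (z t) := fun _ _ => hz _
  have hN1 : MeasurableBounded a b fun t => N1 (z t) := fun _ _ => hz _
  have hl : BddMeas a b fun t => lamW (z t) := hz _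
  have hLam := (MeasurableBounded.const (0 : Matrix (Fin P.nw) (Fin P.np) ℝ)).fromRows
    ((hP.Lam_reg.mono hab).mul hN2)
  have hS := (hP.Sig_reg.mono hab).mul (MeasurableBounded.const P.G)
  exact hN2.neg.fromBlocks hLam.transpose hLam
    ((MeasurableBounded.smul hl (.const 1)).neg.fromBlocks hS.transpose hS hN1.neg)

lemma Regular.invLMI_reg (ty : DynamicsType) (hQ : MeasurableBounded a b Q)
    (hz : ∀ i, BddMeas a b fun t => z t i) :
    MeasurableBounded a b fun t => P.invLMI ty t (Q t) (z t) := by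
  have hZ : MeasurableBounded a b fun t => Z (z t) := fun _ _ => hz _
  have h12 := hP.H12_reg hab hQ hz
  refine MeasurableBounded.fromBlocks ?_ h12.transpose h12 (hP.H22_reg hab hz)
  cases ty
  · exact hZ.neg
  · exact ((hP.H11_reg hab hQ hz).add (hP.H11_reg hab hQ hz).transpose).sub hZ

lemma Regular.stateLMI_reg (i : Fin P.mx) (hQ : MeasurableBounded a b Q) :
    MeasurableBounded a b fun t => P.stateLMI i t (Q t) := by
  have ha : ∀ j, BddMeas a b fun t => P.ah i t j := fun j => (hP.ah_reg i j).mono hab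
  exact (MeasurableBounded.fromBlocks (fun _ _ => (hP.state_corner_reg i).mono hab)
    (fun _ j => (BddMeas.const _).mul
      (BddMeas.sum Finset.univ fun k _ => (ha k).mul (hQ k j)))
    (fun j _ => (BddMeas.const _).mul
      (BddMeas.sum Finset.univ fun k _ => BddMeas.mul (hQ j k) (ha k)))
    (.smul (.const _) hQ)).neg

lemma Regular.inputLMI_reg (i : Fin P.mu) (hQ : MeasurableBounded a b Q)
    (hz : ∀ i, BddMeas a b fun t => z t i) :
    MeasurableBounded a b fun t => P.inputLMI i t (Q t) (z t) := by
  have ha : ∀ j, BddMeas a b fun t => P.ag i t j := fun j => (hP.ag_reg i j).mono hab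
  have hY : MeasurableBounded a b fun t => Y (z t) := fun _ _ => hz _
  exact (MeasurableBounded.fromBlocks (fun _ _ => (hP.input_corner_reg i).mono hab)
    (fun _ j => (BddMeas.const _).mul
      (BddMeas.sum Finset.univ fun k _ => (ha k).mul (hY k j)))
    (fun j _ => (BddMeas.const _).mul
      (BddMeas.sum Finset.univ fun k _ => BddMeas.mul (hY k j) (ha k)))
    (.smul (.const _) hQ)).neg

omit hP hab in
lemma smoothLMI_reg (i : Fin P.nc) (hQ : MeasurableBounded a b Q)
    (hz : ∀ i, BddMeas a b fun t => z t i) :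
    MeasurableBounded a b fun t => P.smoothLMI i (Q t) (z t) := by
  have hch : MeasurableBounded a b fun t => P.channel i (Q t) (z t) := fun r j =>
    channelArg_reg hQ hz ⟨i, r⟩ j
  have hs : BddMeas a b fun t => sVar (z t) i := hz _
  exact (MeasurableBounded.fromBlocks (.smul hs (.const 1)) hch hch.transpose hQ).neg

end Regularity

/-! ### The selection for the constraint violation -/

lemma Icc_node_subset (h : P.t0 ≤ P.tf) {N k : ℕ} (hk : k < N) :
    Icc (P.node N k) (P.node N (k + 1)) ⊆ Icc P.t0 P.tf := by
  have hN : (0 : ℝ) < N := by exact_mod_cast (Nat.zero_le k).trans_lt hk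
  refine Icc_subset_Icc ?_ ?_
  · have : 0 ≤ (k : ℝ) / N * (P.tf - P.t0) := mul_nonneg (by positivity) (sub_nonneg.2 h)
    unfold node
    linarith
  · have h1 : ((k + 1 : ℕ) : ℝ) / N ≤ 1 := (div_le_one hN).2 (by exact_mod_cast hk)
    have := mul_le_mul_of_nonneg_right h1 (sub_nonneg.2 h)
    unfold node
    linarith

/-- A matrix inequality whose matrix is affine and symmetric in `(Q, ζ)`, and measurable and
bounded along measurable bounded arguments, admits the selection of subgradients with respect to
the decision variable. -/
lemma Regular.exists_subgradient_of_lmi (hP : P.Regular) {a b : ℝ}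
    (hab : Icc a b ⊆ Icc P.t0 P.tf) {p : ℝ} (hp : 1 ≤ p) (ty : DynamicsType)
    {Q : P.decisionSpace → ℝ → Matrix (Fin P.nx) (Fin P.nx) ℝ}
    (hQ : ∀ c : P.decisionSpace, IsFunnelState ty a b c.1 (Q c))
    {ι : Type*} [Fintype ι] [DecidableEq ι]
    {L : ℝ → Matrix (Fin P.nx) (Fin P.nx) ℝ → P.InputVec → Matrix ι ι ℝ}
    (haff : ∀ (t r : ℝ) (Q Q' : Matrix (Fin P.nx) (Fin P.nx) ℝ) (z z' : P.InputVec),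
      L t (Q + r • Q') (z + r • z')
      = L t Q z + r • (L t Q' z' - L t 0 0))
    (hsymm : ∀ t Q z, Q.IsSymm → SymmInput z → (L t Q z).IsSymm)
    (hreg : ∀ (Q : ℝ → Matrix (Fin P.nx) (Fin P.nx) ℝ) (z : ℝ → P.InputVec),
      MeasurableBounded a b Q → (∀ i, BddMeas a b fun t => z t i) →
      MeasurableBounded a b fun t => L t (Q t) (z t)) :
    ∃ g : ℝ → P.decisionSpace → P.decisionSpace,
      (∀ c, Measurable fun t => g t c) ∧
      (∀ c, ∀ᵐ t ∂(volume.restrict (Icc a b)), g t c ∈ subdifferential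
        (fun c : P.decisionSpace =>
          max 0 (lambdaMax (L t (Q c t) (foh a b (zetaM c.1) (zetaP c.1) t))) ^ p) c) ∧
      (∀ R : ℝ, ∃ M : ℝ, ∀ c, ‖c‖ ≤ R → ∀ t ∈ Icc a b, ‖g t c‖ ≤ M) ∧
      (∀ c, IntegrableOn (fun t => g t c) (Icc a b)) := by
  have hQlin : ∀ (c c' : P.decisionSpace) (r : ℝ), ∀ t ∈ Icc a b,
      Q (c + r • c') t = Q c t + r • Q c' t := fun c c' r =>
    hP.funnelState_add_smul hab (hQ c) (hQ c') (hQ (c + r • c'))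
  refine exists_measurable_subgradient hp
    (L := fun t (c : P.decisionSpace) => L t (Q c t) (foh a b (zetaM c.1) (zetaP c.1) t))
    (fun t ht c c' r => ?_) (fun t ht c => ?_) (fun c => ?_)
  · have hQ0 : Q 0 t = 0 := by simpa using hQlin 0 0 1 t ht
    have hz0 : foh a b (zetaM (0 : P.decisionSpace).1) (zetaP (0 : P.decisionSpace).1) t = 0 := by
      simpa using foh_add_smul (P := P) a b t 1 0 0
    have hz : foh a b (zetaM (c + r • c').1) (zetaP (c + r • c').1) t
        = foh a b (zetaM c.1) (zetaP c.1) t + r • foh a b (zetaM c'.1) (zetaP c'.1) t :=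
      foh_add_smul a b t r c.1 c'.1
    simp only [hz, hz0, hQ0, hQlin c c' r t ht]
    exact haff _ _ _ _ _ _
  · exact hsymm _ _ _ ((hQ c).isSymm c.2 ht) (foh_symm a b t c.2.2.1 c.2.2.2)
  · exact hreg _ _ (.of_continuousOn (hQ c).1) (foh_reg a b _ _)

end FunnelData

end FunnelSynthesis

open FunnelSynthesis FunnelSynthesis.FunnelData in
theorem theorem2 (P : FunnelData) (hP : P.Regular) (ty : DynamicsType) (l : P.LMIIdx)
    (N k : ℕ) (hk : k < N) (p : ℝ) (hp : 1 ≤ p)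
    (Q : P.decisionSpace → ℝ → Matrix (Fin P.nx) (Fin P.nx) ℝ)
    (hQ : ∀ c : P.decisionSpace, IsFunnelState ty (P.node N k) (P.node N (k + 1)) c.1 (Q c)) :
    ∃ g : ℝ → P.decisionSpace → P.decisionSpace,
      (∀ c, Measurable fun t => g t c) ∧
      (∀ c, ∀ᵐ t ∂(volume.restrict (Icc (P.node N k) (P.node N (k + 1)))),
        g t c ∈ subdifferential
          (violation ty l p (P.node N k) (P.node N (k + 1)) Q t) c) ∧
      (∀ R : ℝ, ∃ M : ℝ, ∀ c, ‖c‖ ≤ R →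
        ∀ t ∈ Icc (P.node N k) (P.node N (k + 1)), ‖g t c‖ ≤ M) ∧
      (∀ c, IntegrableOn (fun t => g t c) (Icc (P.node N k) (P.node N (k + 1)))) := by
  have hab := Icc_node_subset hP.t0_le_tf hk
  cases l with
  | invariance =>
    exact hP.exists_subgradient_of_lmi hab hp ty hQ (L := P.invLMI ty)
      (fun t r Q Q' z z' => invLMI_affine t r Q Q' z z' ty)
      (fun t _ _ _ hz => invLMI_isSymm t ty hz) fun _ _ => hP.invLMI_reg hab ty
  | state i =>
    exact hP.exists_subgradient_of_lmi hab hp ty hQ (L := fun t Q _ => P.stateLMI i t Q)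
      (fun t r Q Q' _ _ => stateLMI_affine t r Q Q' i)
      (fun t _ _ hQ _ => stateLMI_isSymm t i hQ) fun _ _ hQ _ => hP.stateLMI_reg hab i hQ
  | input j =>
    exact hP.exists_subgradient_of_lmi hab hp ty hQ (L := P.inputLMI j)
      (fun t r Q Q' z z' => inputLMI_affine t r Q Q' z z' j)
      (fun t _ _ hQ _ => inputLMI_isSymm t j hQ) fun _ _ => hP.inputLMI_reg hab j
  | smooth i =>
    exact hP.exists_subgradient_of_lmi hab hp ty hQ (L := fun _ => P.smoothLMI i)
      (fun _ r Q Q' z z' => smoothLMI_affine r Q Q' z z' i)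
      (fun _ _ _ hQ _ => smoothLMI_isSymm i hQ) fun _ _ => smoothLMI_reg i
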